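/- Let $\mathfrak B$ be a real or complex Banach space, $[\mathfrak B]$ the Banach algebra of bounded linear operators on $\mathfrak B$, and let $A:\mathbb R\to[\mathfrak B]$, $f:\mathbb R\to\mathfrak B$, $F:\mathbb R\times\mathfrak B\to\mathfrak B$ be continuous. Let $U(t)$ be the Cauchy operator of $x'=A(t)x$, i.e. $U'(t)=A(t)U(t)$, $U(0)=I$. **Definitions.** A continuous function $g:\mathbb R\to X$ (resp. $g:\mathbb R\times W\to X$) is *Lagrange stable* if the set of its translates $g(\cdot+h)$ (resp. $g(\cdot+h,\cdot)$), $h\in\mathbb R$, is precompact in the compact-open topology. For $X$ a metric space with distance $\rho$ and $\tau>0$, a function $g:\mathbb R\to X$ is * *two-sided remotely $\tau$-periodic* if $\rho(g(t+\tau),g(t))\to0$ as $t\to+\infty$ and as $t\to-\infty$; * *two-sided remotely stationary* if it is two-sided remotely $\tau$-periodic for every $\tau>0$; * *two-sided remotely almost periodic* if for every $\varepsilon>0$ there is a relatively dense set $S\subseteq\mathbb R$ such that for every $\tau\in S$ there is $\ell>0$ with $\rho(g(t+\tau),g(t))<\varepsilon$ for all $|t|\ge \ell$. ($S$ is relatively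 dense if for some $l>0$ it meets every interval $[a,a+l]$.) For $F_Q:=F|_{\mathbb R\times Q}$ these notions are understood in $t$, uniformly with respect to $x\in Q$. **Assumptions.** 1. $x'=A(t)x$ has an exponential trichotomy on $\mathbb R$: there are projections $P,Q_0\in[\mathfrak B]$ with $PQ_0=Q_0P$, $P+Q_0-PQ_0=I$, and constants $\mathcal N\ge1$, $\nu>0$ such that $$\begin{aligned} \|U(t)PU^{-1}(\tau)\|&\le\mathcal Ne^{-\nu(t-\tau)} && (0\le\tau\le t),\\ \|U(t)(I-P)U^{-1}(\tau)\|&\le\mathcal Ne^{-\nu(\tau-t)} && (t\le\tau,\ \tau\ge0),\\ \|U(t)Q_0U^{-1}(\tau)\|&\le\mathcal Ne^{-\nu(\tau-t)} && (t\le\tau\le0),\\ \|U(t)(I-Q_0)U^{-1}(\tau)\|&\le\mathcal Ne^{-\nu(t-\tau)} && (\tau\le t,\ \tau\le0). \end{aligned}$$ 2. Condition (C): the sets $\{U(t)PU^{-1}(t): t\ge0\}$ and $\{U(t)(I-Q_0)U^{-1}(t): t\le0\}$ are precompact in $[\mathfrak B]$. 3. $A$, $f$ and $F$ are Lagrange stable.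 4. $|F(t,u)-F(t,v)|\le L|u-v|$ for all $t\in\mathbb R$, $u,v\in\mathfrak B$, where $0\le L<\nu/(2\mathcal N)$. Let $$G(t,\tau)=\begin{cases}U(t)PU^{-1}(\tau), & 0\le\tau<t,\\ -U(t)(I-P)U^{-1}(\tau), & \tau\ge0,\ t\le\tau,\\ -U(t)Q_0U^{-1}(\tau), & \tau<0,\ t\le\tau,\\ U(t)(I-Q_0)U^{-1}(\tau), & \tau<0,\ \tau<t.\end{cases}$$ **Conclusion.** There is exactly one Lagrange stable solution $\varphi$ on $\mathbb R$ of $$u'=A(t)u+f(t)+F(t,u)\qquad(\ast)$$ that satisfies $\varphi(t)=\int_{-\infty}^{+\infty}G(t,\tau)\,[f(\tau)+F(\tau,\varphi(\tau))]\,d\tau$ for all $t\in\mathbb R$ (with convergent integrals). Moreover, let $\varphi$ be this solution, or more generally any Lagrange stable solution of $(\ast)$ on $\mathbb R$, and put $Q:=\overline{\varphi(\mathbb R)}$. If $A$, $f$ and $F_Q$ are all two-sided remotely stationary (respectively, two-sided remotely $\tau$-periodic for a given $\tau>0$, two-sided remotely almost periodic), then $\varphi$ is two-sided remotely stationary (respectively,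 two-sided remotely $\tau$-periodic, two-sided remotely almost periodic). -/

import Mathlib

open Set Filter Topology MeasureTheory
open scoped NNReal

/-! ### Shifts, Lagrange stability and two-sided remote recurrence -/

/-- The translation `φ ↦ φ(· + h)` on the space `C(ℝ, X)`. -/
def timeShift {X : Type*} [TopologicalSpace X] (h : ℝ) (φ : C(ℝ, X)) : C(ℝ, X) :=
  φ.comp ⟨fun t => t + h, by fun_prop⟩

/-- The translation `F ↦ F(· + h, ·)` on the space `C(ℝ × W, X)`. -/
def timeShift₂ {W X : Type*} [TopologicalSpace W] [TopologicalSpace X] (h : ℝ)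
    (F : C(ℝ × W, X)) : C(ℝ × W, X) :=
  F.comp ⟨fun p => (p.1 + h, p.2), by fun_prop⟩

/-- `φ` is Lagrange stable: its translations form a precompact set in the compact-open topology. -/
def LagrangeStable {X : Type*} [TopologicalSpace X] (φ : C(ℝ, X)) : Prop :=
  IsCompact (closure (range fun h : ℝ => timeShift h φ))

/-- Lagrange stability in the first variable for functions of two variables, in the compact-open
topology of `C(ℝ × W, X)`. -/
def LagrangeStable₂ {W X : Type*} [TopologicalSpace W] [TopologicalSpace X]
    (F : C(ℝ × W, X)) : Prop :=
  IsCompact (closure (range fun h : ℝ => timeShift₂ h F))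

/-- A relatively dense subset of the real line. -/
def RelativelyDense (S : Set ℝ) : Prop :=
  ∃ l > 0, ∀ a : ℝ, (Icc a (a + l) ∩ S).Nonempty

section Recurrence

variable {W X : Type*} [PseudoMetricSpace X]

/-- `φ` is two-sided (positively and negatively) remotely `τ`-periodic. -/
def RemotelyPeriodic (τ : ℝ) (φ : ℝ → X) : Prop :=
  Tendsto (fun t => dist (φ (t + τ)) (φ t)) atTop (𝓝 0) ∧
    Tendsto (fun t => dist (φ (t + τ)) (φ t)) atBot (𝓝 0)

/-- `φ` is two-sided remotely stationary. -/
def RemotelyStationary (φ : ℝ → X) : Prop :=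
  ∀ τ > 0, RemotelyPeriodic τ φ

/-- `φ` is two-sided remotely almost periodic. -/
def RemotelyAlmostPeriodic (φ : ℝ → X) : Prop :=
  ∀ ε > 0, ∃ S : Set ℝ, RelativelyDense S ∧
    ∀ τ ∈ S, ∃ L > 0, ∀ t : ℝ, L ≤ |t| → dist (φ (t + τ)) (φ t) < ε

/-- The restriction of `F` to `ℝ × Q` is two-sided remotely `τ`-periodic in the first variable,
uniformly with respect to the second one in `Q`. -/
def RemotelyPeriodicOn (τ : ℝ) (F : ℝ × W → X) (Q : Set W) : Prop :=
  ∀ ε > 0, (∀ᶠ t in atTop, ∀ x ∈ Q, dist (F (t + τ, x)) (F (t, x)) < ε) ∧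
    ∀ᶠ t in atBot, ∀ x ∈ Q, dist (F (t + τ, x)) (F (t, x)) < ε

/-- The restriction of `F` to `ℝ × Q` is two-sided remotely stationary in the first variable,
uniformly with respect to the second one in `Q`. -/
def RemotelyStationaryOn (F : ℝ × W → X) (Q : Set W) : Prop :=
  ∀ τ > 0, RemotelyPeriodicOn τ F Q

/-- The restriction of `F` to `ℝ × Q` is two-sided remotely almost periodic in the first variable,
uniformly with respect to the second one in `Q`. -/
def RemotelyAlmostPeriodicOn (F : ℝ × W → X) (Q : Set W) : Prop :=
  ∀ ε > 0, ∃ S : Set ℝ, RelativelyDense S ∧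
    ∀ τ ∈ S, ∃ L > 0, ∀ t : ℝ, L ≤ |t| → ∀ x ∈ Q, dist (F (t + τ, x)) (F (t, x)) < ε

end Recurrence

/-! ### The Cauchy operator -/

/-- Global solvability of linear ordinary differential equations with continuous coefficients. -/
theorem exists_linear_ode {F : Type*} [NormedAddCommGroup F] [NormedSpace ℝ F] [CompleteSpace F]
    (L : ℝ → F →L[ℝ] F) (hL : Continuous L) (y : F) :
    ∃ u : ℝ → F, u 0 = y ∧ ∀ t, HasDerivAt u (L t (u t)) t := by
  let I : ℕ → ℝ → F := fun n =>
    Nat.rec (fun _ => y) (fun _ g t => ∫ s in (0 : ℝ)..t, L s (g s)) n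
  have I0 : ∀ t, I 0 t = y := fun _ => rfl
  have IS : ∀ n t, I (n + 1) t = ∫ s in (0 : ℝ)..t, L s (I n s) := fun _ _ => rfl
  have hc : ∀ n, Continuous (I n) := by
    intro n
    induction n with
    | zero => exact continuous_const
    | succ n ih =>
      have : Continuous fun s => L s (I n s) := hL.clm_apply ih
      exact intervalIntegral.continuous_primitive (fun a b => this.intervalIntegrable a b) 0
  have hd : ∀ n t, HasDerivAt (I (n + 1)) (L t (I n t)) t := by
    intro n t
    have : Continuous fun s => L s (I n s) := hL.clm_apply (hc n)
    exact this.integral_hasStrictDerivAt 0 t |>.hasDerivAt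
  have key : ∀ T > 0, ∀ t ∈ Ioo (-T) T, Summable (fun n => I n t) ∧
      HasDerivAt (fun z => ∑' n, I (n + 1) z) (∑' n, L t (I n t)) t := by
    intro T hT
    obtain ⟨M, hM⟩ := (isCompact_Icc (a := -T) (b := T)).exists_bound_of_continuousOn
      hL.continuousOn
    have hM0 : 0 ≤ M := (norm_nonneg _).trans (hM 0 ⟨by linarith, hT.le⟩)
    have hb : ∀ n, ∀ t ∈ Icc (-T) T, ‖I n t‖ ≤ M ^ n * |t| ^ n / n.factorial * ‖y‖ := by
      intro n
      induction n with
      | zero => intro t _; simp [I0]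
      | succ n ih =>
        intro t ht
        rw [IS]
        have hsub : ∀ s ∈ uIoc 0 t, s ∈ Icc (-T) T := by
          intro s hs
          have := uIoc_subset_uIcc hs
          have h2 : uIcc 0 t ⊆ Icc (-T) T := uIcc_subset_Icc ⟨by linarith, hT.le⟩ ht
          exact h2 this
        have h1 : ∫ s in uIoc 0 t, M * (M ^ n * |s| ^ n / n.factorial * ‖y‖)
            = M ^ (n + 1) * |t| ^ (n + 1) / (n + 1).factorial * ‖y‖ := by
          have h3 := integral_pow_abs_sub_uIoc (a := 0) (b := t) (n := n)
          simp only [sub_zero] at h3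
          have : ∀ s : ℝ, M * (M ^ n * |s| ^ n / n.factorial * ‖y‖)
              = (M ^ (n + 1) / n.factorial * ‖y‖) * |s| ^ n := by intro s; ring
          simp_rw [this]
          rw [integral_const_mul, h3, Nat.factorial_succ]
          push_cast
          field_simp
        rw [← h1]
        refine intervalIntegral.norm_integral_le_integral_norm_uIoc.trans ?_
        refine setIntegral_mono_on ?_ ?_ measurableSet_uIoc ?_
        · exact ((hL.clm_apply (hc n)).norm.intervalIntegrable 0 t).def'
        · refine (Continuous.intervalIntegrable ?_ 0 t).def'
          fun_prop
        · intro s hs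
          exact ((L s).le_opNorm _).trans
            (mul_le_mul (hM s (hsub s hs)) (ih s (hsub s hs)) (norm_nonneg _) hM0)
    have hb' : ∀ n, ∀ t ∈ Icc (-T) T, ‖I n t‖ ≤ (M * T) ^ n / n.factorial * ‖y‖ := by
      intro n t ht
      refine (hb n t ht).trans ?_
      rw [← mul_pow]
      have : |t| ≤ T := abs_le.2 ht
      gcongr
    have hs : Summable fun n : ℕ => (M * T) ^ n / n.factorial * ‖y‖ :=
      (Real.summable_pow_div_factorial (M * T)).mul_right _
    have hsI : ∀ t ∈ Icc (-T) T, Summable fun n => I n t := fun t ht =>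
      Summable.of_norm_bounded hs (fun n => hb' n t ht)
    intro t ht
    refine ⟨hsI t (Ioo_subset_Icc_self ht), ?_⟩
    refine hasDerivAt_tsum_of_isPreconnected (hs.mul_left M) isOpen_Ioo isPreconnected_Ioo
      (fun n z _ => hd n z) ?_ (y₀ := t) ht ?_ ht
    · intro n z hz
      exact ((L z).le_opNorm _).trans (mul_le_mul (hM z (Ioo_subset_Icc_self hz))
        (hb' n z (Ioo_subset_Icc_self hz)) (norm_nonneg _) hM0)
    · exact (summable_nat_add_iff 1).2 (hsI t (Ioo_subset_Icc_self ht))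
  have hmem : ∀ t : ℝ, t ∈ Ioo (-(|t| + 1)) (|t| + 1) := fun t =>
    abs_lt.1 (by linarith)
  have hpos : ∀ t : ℝ, 0 < |t| + 1 := fun t => by positivity
  refine ⟨fun t => y + ∑' n, I (n + 1) t, ?_, fun t => ?_⟩
  · simp [IS]
  · obtain ⟨h1, h2⟩ := key _ (hpos t) t (hmem t)
    have h3 : L t (y + ∑' n, I (n + 1) t) = ∑' n, L t (I n t) := by
      have := h1.tsum_eq_zero_add
      rw [I0] at this
      rw [← this, (L t).map_tsum h1]
    rw [h3]
    exact h2.const_add y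

/-- In a Banach algebra the problem `U' = A U`, `U 0 = 1` has an invertible solution. -/
theorem exists_units_ode {R : Type*} [NormedRing R] [NormedAlgebra ℝ R] [CompleteSpace R]
    (A : ℝ → R) (hA : Continuous A) :
    ∃ U : ℝ → Rˣ, (U 0 : R) = 1 ∧ ∀ t, HasDerivAt (fun s => (U s : R)) (A t * (U t : R)) t := by
  obtain ⟨U, U0, hU⟩ := exists_linear_ode (fun t => ContinuousLinearMap.mul ℝ R (A t))
    ((ContinuousLinearMap.mul ℝ R).continuous.comp hA) 1
  obtain ⟨V, V0, hV⟩ := exists_linear_ode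
    (fun t => -(ContinuousLinearMap.mul ℝ R).flip (A t))
    ((ContinuousLinearMap.mul ℝ R).flip.continuous.comp hA).neg 1
  simp only [ContinuousLinearMap.mul_apply', neg_apply,
    ContinuousLinearMap.flip_apply] at hU hV
  have hVU : ∀ t, V t * U t = 1 := by
    intro t
    have hd : ∀ t, HasDerivAt (fun s => V s * U s) 0 t := by
      intro t
      have := (hV t).mul (hU t)
      have h0 : -(V t * A t) * U t + V t * (A t * U t) = 0 := by noncomm_ring
      rw [h0] at this
      exact this
    have := is_const_of_deriv_eq_zero (fun s => (hd s).differentiableAt)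
      (fun s => (hd s).deriv) t 0
    simpa [U0, V0] using this
  have cU : Continuous U := continuous_iff_continuousAt.2 fun t => (hU t).continuousAt
  have cV : Continuous V := continuous_iff_continuousAt.2 fun t => (hV t).continuousAt
  have hUV : {t | U t * V t = 1} = univ := by
    refine IsClopen.eq_univ ⟨isClosed_eq (cU.mul cV) continuous_const, ?_⟩ ⟨0, by simp [U0, V0]⟩
    rw [isOpen_iff_mem_nhds]
    intro t ht
    have hu : IsUnit (U t) := ⟨⟨U t, V t, ht, hVU t⟩, rfl⟩
    filter_upwards [cU.continuousAt.preimage_mem_nhds (Units.isOpen.mem_nhds hu)] with s hs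
    obtain ⟨w, hw⟩ := hs
    have := hVU s
    have h1 : V s = ↑w⁻¹ := by
      rw [← hw] at this
      calc V s = V s * w * ↑w⁻¹ := by rw [mul_assoc, Units.mul_inv, mul_one]
        _ = ↑w⁻¹ := by rw [this, one_mul]
    show U s * V s = 1
    rw [h1, ← hw, Units.mul_inv]
  have hUV' : ∀ t, U t * V t = 1 := fun t => by
    have : t ∈ {t | U t * V t = 1} := hUV ▸ mem_univ t
    exact this
  exact ⟨fun t => ⟨U t, V t, hUV' t, hVU t⟩, U0, hU⟩

section Trichotomy

variable {𝕜 E : Type*} [RCLike 𝕜] [NormedAddCommGroup E] [NormedSpace ℝ E] [NormedSpace 𝕜 E]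
  [IsScalarTower ℝ 𝕜 E] [CompleteSpace E]

/-- The linear equation `x' = A(t) x` has an (invertible) operator solution equal to the identity
at time `0`. -/
theorem exists_cauchyOperator (A : C(ℝ, E →L[𝕜] E)) :
    ∃ U : ℝ → (E →L[𝕜] E)ˣ, U 0 = 1 ∧
      ∀ t, HasDerivAt (fun s => (U s : E →L[𝕜] E)) (A t * (U t : E →L[𝕜] E)) t := by
  let _ : Algebra ℝ (E →L[𝕜] E) := Algebra.ofModule
    (fun r x y => by ext; rfl)
    (fun r x y => by
      ext z
      exact map_real_smul x.toAddMonoidHom x.continuous r (y z))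
  let _ : NormedAlgebra ℝ (E →L[𝕜] E) := { norm_smul_le := norm_smul_le }
  obtain ⟨U, h0, h⟩ := exists_units_ode A A.continuous
  exact ⟨U, Units.ext h0, h⟩

/-- The Cauchy operator `U(t, A)` of `x' = A(t) x`: the (unique) solution of `U' = A U`, `U(0) = I`
in the space of bounded operators. Its values are invertible. -/
noncomputable def cauchyOperator (A : C(ℝ, E →L[𝕜] E)) : ℝ → (E →L[𝕜] E)ˣ :=
  Classical.choose (exists_cauchyOperator A)

theorem cauchyOperator_zero (A : C(ℝ, E →L[𝕜] E)) : cauchyOperator A 0 = 1 :=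
  (Classical.choose_spec (exists_cauchyOperator A)).1

theorem hasDerivAt_cauchyOperator (A : C(ℝ, E →L[𝕜] E)) (t : ℝ) :
    HasDerivAt (fun s => (cauchyOperator A s : E →L[𝕜] E))
      (A t * (cauchyOperator A t : E →L[𝕜] E)) t :=
  (Classical.choose_spec (exists_cauchyOperator A)).2 t

/-- The operator `U(t, A) T U⁻¹(τ, A)`. -/
noncomputable def conjOp (A : C(ℝ, E →L[𝕜] E)) (T : E →L[𝕜] E) (t τ : ℝ) : E →L[𝕜] E :=
  (cauchyOperator A t : E →L[𝕜] E) * T * ((cauchyOperator A τ)⁻¹ : (E →L[𝕜] E)ˣ)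

/-! ### Exponential trichotomy, the precompactness condition, Green's function -/

/-- The equation `x' = A(t) x` has an exponential trichotomy on `ℝ` with projections `P`, `Q` and
constants `N`, `ν`. -/
structure HasExpTrichotomy (A : C(ℝ, E →L[𝕜] E)) (P Q : E →L[𝕜] E) (N ν : ℝ) : Prop where
  proj_left : P * P = P
  proj_right : Q * Q = Q
  comm : P * Q = Q * P
  sum : P + Q - P * Q = 1
  one_le : 1 ≤ N
  pos : 0 < ν
  bound_P : ∀ t τ, 0 ≤ τ → τ ≤ t → ‖conjOp A P t τ‖ ≤ N * Real.exp (-ν * (t - τ))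
  bound_compl_P : ∀ t τ, t ≤ τ → 0 ≤ τ → ‖conjOp A (1 - P) t τ‖ ≤ N * Real.exp (-ν * (τ - t))
  bound_Q : ∀ t τ, t ≤ τ → τ ≤ 0 → ‖conjOp A Q t τ‖ ≤ N * Real.exp (-ν * (τ - t))
  bound_compl_Q : ∀ t τ, τ ≤ t → τ ≤ 0 → ‖conjOp A (1 - Q) t τ‖ ≤ N * Real.exp (-ν * (t - τ))

/-- The precompactness condition for an equation with a trichotomy, that is, for its dichotomy on `[0, ∞)` with
projection `P` and its dichotomy on `(-∞, 0]` with projection `1 - Q`: the projectors carried along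
the equation form precompact sets of operators. -/
def ConditionC (A : C(ℝ, E →L[𝕜] E)) (P Q : E →L[𝕜] E) : Prop :=
  IsCompact (closure ((fun t => conjOp A P t t) '' Ici 0)) ∧
    IsCompact (closure ((fun t => conjOp A (1 - Q) t t) '' Iic 0))

open Classical in
/-- Green's function of an equation with a trichotomy. -/
noncomputable def greenFunction (A : C(ℝ, E →L[𝕜] E)) (P Q : E →L[𝕜] E) (t τ : ℝ) : E →L[𝕜] E :=
  if 0 ≤ τ then
    if τ < t then conjOp A P t τ else -conjOp A (1 - P) t τ
  else
    if t ≤ τ then -conjOp A Q t τ else conjOp A (1 - Q) t τ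

/-! ### The semilinear equation -/

/-- `φ` is a solution on `ℝ` of `u' = A(t) u + f(t) + F(t, u)`. -/
def IsSolution (A : C(ℝ, E →L[𝕜] E)) (f : C(ℝ, E)) (F : C(ℝ × E, E)) (φ : C(ℝ, E)) : Prop :=
  ∀ t, HasDerivAt φ (A t (φ t) + f t + F (t, φ t)) t

/-- `φ(t) = ∫ G(t, τ) (f(τ) + F(τ, φ(τ))) dτ` for all `t`, the integral being convergent. -/
def IsGreenSolution (A : C(ℝ, E →L[𝕜] E)) (P Q : E →L[𝕜] E) (f : C(ℝ, E)) (F : C(ℝ × E, E))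
    (φ : C(ℝ, E)) : Prop :=
  ∀ t, Integrable (fun τ => greenFunction A P Q t τ (f τ + F (τ, φ τ))) ∧
    φ t = ∫ τ, greenFunction A P Q t τ (f τ + F (τ, φ τ))

end Trichotomy

/-!
Write `S g (t) = ∫ G(t, τ) g(τ) dτ` for the Green operator. By the trichotomy
`‖G(t, τ)‖ ≤ N exp (-ν |t - τ|)`, so `S` has norm at most `2 N / ν` in the supremum norm, and
`φ ↦ S (f + F(·, φ))` is a contraction of the space of bounded continuous functions. Bounded Green
solutions are its fixed points; they solve the differential equation because `G` jumps by the
identity at `τ = t` (`HasExpTrichotomy.hasDerivAt_integral_greenFunction`).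

The fixed point is Lipschitz, having a bounded derivative, so by Arzelà–Ascoli it is Lagrange stable
as soon as its range is relatively compact. Functions with relatively compact range are preserved by
`S` (`HasExpTrichotomy.totallyBounded_range_integral_greenFunction`): the tails of the integral
are uniformly small, and the rest is a mean of vectors `G(t, τ) g(τ)` with `|t - τ|` bounded. These
form a relatively compact set because `G(t, τ)` is, up to sign, the evolution operator from `τ` to
`t` composed with one of the projectors at time `τ`, which condition (C) makes relatively compact,
while the evolution operators over bounded time spans are relatively compact by their integral
equation (`totallyBounded_conjOp_one`).

The recurrence is a stability estimate near `±∞`. If `φ` is a bounded solution, then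
`w(t) = φ(t + τ) - φ(t)` solves `w' = A(t) w + g(t)` with `‖g‖ ≤ r + L ‖w‖`, where `r` is small near
`±∞` as soon as `τ` is a remote almost period of `A`, `f` and `F` on the closure of the range of
`φ`. On each half-line the equation has an exponential dichotomy, and variation of constants bounds
the upper limit `m` of `‖w‖` by `(2 N / ν) (sup r + L m)`; as `2 N L / ν < 1`, it is at most a
multiple of `sup r` (`HasExpTrichotomy.eventually_norm_le`).

In the almost periodic case `A`, `f` and `F` have to share their almost periods. Lagrange stability
makes small shifts almost periods, and then relative density of the `ε`-almost periods for every `ε`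
means that the line is totally bounded in the translation invariant metric that they define. Total
boundedness passes to finitely many metrics at once (`AlmostPeriodFamily.and`).
-/

/-! ### Total boundedness and integral means -/

open Metric in
/-- A set that is approximated to any accuracy by totally bounded sets is totally bounded. -/
theorem totallyBounded_of_subset_cthickening {X : Type*} [PseudoMetricSpace X] {s : Set X}
    (h : ∀ ε > 0, ∃ K : Set X, TotallyBounded K ∧ s ⊆ cthickening ε K) : TotallyBounded s := by
  rw [Metric.totallyBounded_iff]
  intro ε hε
  obtain ⟨K, hK, hs⟩ := h (ε / 3) (by positivity)
  obtain ⟨t, ht, hKt⟩ := Metric.totallyBounded_iff.1 hK (ε / 3) (by positivity)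
  refine ⟨t, ht, fun x hx => ?_⟩
  obtain ⟨z, hz, hxz⟩ := Metric.mem_thickening_iff.1
    (cthickening_subset_thickening' (by positivity : 0 < ε / 2) (by linarith) K (hs hx))
  obtain ⟨y, hy, hzy⟩ := mem_iUnion₂.1 (hKt hz)
  refine mem_iUnion₂.2 ⟨y, hy, ?_⟩
  rw [mem_ball] at hzy ⊢
  linarith [dist_triangle x z y]

theorem isCompact_closure_of_totallyBounded {X : Type*} [UniformSpace X] [CompleteSpace X]
    {s : Set X} (h : TotallyBounded s) : IsCompact (closure s) :=
  h.closure.isCompact_of_isClosed isClosed_closure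

theorem totallyBounded_of_isCompact_closure {X : Type*} [UniformSpace X]
    {s : Set X} (h : IsCompact (closure s)) : TotallyBounded s :=
  h.totallyBounded.subset subset_closure

theorem exists_intervalIntegral_eq_smul {F : Type*} [NormedAddCommGroup F] [NormedSpace ℝ F]
    [CompleteSpace F] {C : Set F} (hC : Convex ℝ C) (hcl : IsClosed C) (hne : C.Nonempty)
    {h : ℝ → F} {a b : ℝ} (hi : IntervalIntegrable h volume a b) (hm : ∀ s ∈ uIoc a b, h s ∈ C) :
    ∃ c ∈ C, ∫ s in a..b, h s = (b - a) • c := by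
  rcases eq_or_ne a b with rfl | hab
  · obtain ⟨c, hc⟩ := hne
    exact ⟨c, hc, by simp⟩
  · refine ⟨⨍ s in a..b, h s, ?_, ?_⟩
    · refine hC.set_average_mem hcl ?_ ?_ ?_ hi.def'
      · rw [Real.volume_uIoc]
        simpa [sub_eq_zero] using hab.symm
      · rw [Real.volume_uIoc]
        exact ENNReal.ofReal_ne_top
      · exact (ae_restrict_iff' measurableSet_uIoc).2 (Eventually.of_forall hm)
    · rw [interval_average_eq, smul_smul, mul_inv_cancel₀ (sub_ne_zero.2 hab.symm), one_smul]

open Metric in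
/-- Integrals, over intervals of length at most `T`, of functions with values within `ε` of a
compact set `D` are within `T * ε` of a compact set that depends on `T` and `D` only. -/
theorem exists_isCompact_intervalIntegral_mem {F : Type*} [NormedAddCommGroup F]
    [NormedSpace ℝ F] [CompleteSpace F] {D : Set F} (hD : IsCompact D) (T : ℝ) :
    ∃ K : Set F, IsCompact K ∧ ∀ (ε : ℝ) (h : ℝ → F) (a b : ℝ), 0 ≤ ε → |b - a| ≤ T →
      IntervalIntegrable h volume a b → (∀ s ∈ uIoc a b, h s ∈ cthickening ε D) →
      ∫ s in a..b, h s ∈ cthickening (T * ε) K := by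
  set C : Set F := closure (convexHull ℝ (insert 0 D)) with hCdef
  have hCc : IsCompact C :=
    isCompact_closure_of_totallyBounded (hD.insert 0).totallyBounded.convexHull
  have hCv : Convex ℝ C := (convex_convexHull ℝ _).closure
  have hDC : D ⊆ C :=
    (subset_insert 0 D).trans ((subset_convexHull ℝ _).trans subset_closure)
  have h0 : (0 : F) ∈ C := subset_closure (subset_convexHull ℝ _ (mem_insert 0 D))
  refine ⟨(fun p : ℝ × F => p.1 • p.2) '' (Icc (-T) T ×ˢ C),
    (isCompact_Icc.prod hCc).image (by fun_prop), fun ε h a b hε hab hi hm => ?_⟩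
  obtain ⟨c, hc, hcI⟩ := exists_intervalIntegral_eq_smul (hCv.cthickening ε)
    isClosed_cthickening ⟨0, self_subset_cthickening C h0⟩ hi
    (fun s hs => cthickening_subset_of_subset ε hDC (hm s hs))
  rw [hCc.cthickening_eq_biUnion_closedBall hε] at hc
  obtain ⟨d, hd, hcd⟩ := mem_iUnion₂.1 hc
  rw [hcI]
  refine mem_cthickening_of_dist_le _ ((b - a) • d) _ _ ⟨(b - a, d), ⟨abs_le.1 hab, hd⟩, rfl⟩ ?_
  rw [dist_smul₀, Real.norm_eq_abs]
  exact mul_le_mul hab hcd dist_nonneg ((abs_nonneg _).trans hab)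

/-! ### Lagrange stable functions -/

section Lagrange

variable {X : Type*}

theorem LagrangeStable.isCompact_closure_range [TopologicalSpace X] [T2Space X] {φ : C(ℝ, X)}
    (h : LagrangeStable φ) : IsCompact (closure (range φ)) := by
  have hc : Continuous fun ψ : C(ℝ, X) => ψ 0 := continuous_eval_const 0
  refine (h.image hc).closure_of_subset ?_
  rintro _ ⟨t, rfl⟩
  exact ⟨timeShift t φ, subset_closure ⟨t, rfl⟩, by simp [timeShift]⟩

/-- The members of a compact set of functions are equicontinuous at time `0`, uniformly over the
compact space `W` of parameters. -/
theorem IsCompact.exists_dist_lt_of_abs_lt {W : Type*} [TopologicalSpace W] [CompactSpace W]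
    [PseudoMetricSpace X] {S : Set C(ℝ × W, X)} [LocallyCompactPair (ℝ × W) X]
    (hS : IsCompact S) {ε : ℝ} (hε : 0 < ε) :
    ∃ δ > 0, ∀ τ : ℝ, |τ| < δ → ∀ H ∈ S, ∀ x, dist (H (τ, x)) (H (0, x)) < ε := by
  have hc : Continuous fun p : ℝ × (C(ℝ × W, X) × W) =>
      dist (p.2.1 (p.1, p.2.2)) (p.2.1 (0, p.2.2)) := by fun_prop
  obtain ⟨u, v, hu, -, h0, hv, huv⟩ := generalized_tube_lemma (isCompact_singleton (x := (0 : ℝ)))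
    (hS.prod (isCompact_univ (X := W))) ((isOpen_Iio (a := ε)).preimage hc)
    (by rintro ⟨τ, H, x⟩ ⟨h1, -⟩; obtain rfl : τ = 0 := h1; simpa using hε)
  obtain ⟨δ, hδ, hb⟩ := Metric.isOpen_iff.1 hu 0 (h0 rfl)
  refine ⟨δ, hδ, fun τ hτ H hH x => ?_⟩
  exact huv (show (τ, H, x) ∈ u ×ˢ v from ⟨hb (by simpa using hτ), hv ⟨hH, mem_univ x⟩⟩)

theorem LagrangeStable.exists_dist_lt [PseudoMetricSpace X] {φ : C(ℝ, X)}
    (h : LagrangeStable φ) {ε : ℝ} (hε : 0 < ε) :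
    ∃ δ > 0, ∀ τ : ℝ, |τ| < δ → ∀ t, dist (φ (t + τ)) (φ t) < ε := by
  have hS := h.image (ContinuousMap.continuous_precomp
    (⟨Prod.fst, continuous_fst⟩ : C(ℝ × Unit, ℝ)))
  obtain ⟨δ, hδ, H⟩ := hS.exists_dist_lt_of_abs_lt hε
  refine ⟨δ, hδ, fun τ hτ t => ?_⟩
  have := H τ hτ _ ⟨timeShift t φ, subset_closure ⟨t, rfl⟩, rfl⟩ ()
  simpa [timeShift, add_comm τ t] using this

section TwoVariables

variable {W : Type*} [TopologicalSpace W]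

/-- The restrictions to `ℝ × K` of the translates of a Lagrange stable function lie in a compact
set of functions. -/
theorem LagrangeStable₂.exists_isCompact_restrict [TopologicalSpace X] {F : C(ℝ × W, X)}
    (h : LagrangeStable₂ F) (K : Set W) :
    ∃ S : Set C(ℝ × K, X), IsCompact S ∧
      ∀ t : ℝ, ∃ H ∈ S, ∀ (s : ℝ) (x : K), H (s, x) = F (s + t, x) := by
  have hS := h.image (ContinuousMap.continuous_precomp
    (⟨fun p : ℝ × K => (p.1, (p.2 : W)), by fun_prop⟩ : C(ℝ × K, ℝ × W)))
  exact ⟨_, hS, fun t => ⟨_, ⟨timeShift₂ t F, subset_closure ⟨t, rfl⟩, rfl⟩, fun s x => rfl⟩⟩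

theorem LagrangeStable₂.exists_dist_lt [PseudoMetricSpace X] [R1Space W] {F : C(ℝ × W, X)}
    (h : LagrangeStable₂ F) {K : Set W} (hK : IsCompact K) {ε : ℝ} (hε : 0 < ε) :
    ∃ δ > 0, ∀ τ : ℝ, |τ| < δ → ∀ t, ∀ x ∈ K, dist (F (t + τ, x)) (F (t, x)) < ε := by
  have := isCompact_iff_compactSpace.1 hK
  obtain ⟨S, hS, H⟩ := h.exists_isCompact_restrict K
  obtain ⟨δ, hδ, H'⟩ := hS.exists_dist_lt_of_abs_lt hε
  refine ⟨δ, hδ, fun τ hτ t x hx => ?_⟩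
  obtain ⟨H, hHS, hH⟩ := H t
  have := H' τ hτ H hHS ⟨x, hx⟩
  simpa [hH, add_comm τ t] using this

theorem LagrangeStable₂.exists_isCompact_mem [TopologicalSpace X] [R1Space W] {F : C(ℝ × W, X)}
    (h : LagrangeStable₂ F) {K : Set W} (hK : IsCompact K) :
    ∃ K' : Set X, IsCompact K' ∧ ∀ t, ∀ x ∈ K, F (t, x) ∈ K' := by
  have := isCompact_iff_compactSpace.1 hK
  obtain ⟨S, hS, H⟩ := h.exists_isCompact_restrict K
  have hc : Continuous fun p : C(ℝ × K, X) × K => p.1 (0, p.2) := by fun_prop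
  refine ⟨_, (hS.prod isCompact_univ).image hc, fun t x hx => ?_⟩
  obtain ⟨H, hHS, hH⟩ := H t
  exact ⟨(H, ⟨x, hx⟩), ⟨hHS, mem_univ _⟩, by simp [hH]⟩

end TwoVariables

/-- By the Arzelà–Ascoli theorem, a Lipschitz function with totally bounded range is Lagrange
stable. -/
theorem lagrangeStable_of_lipschitzWith [MetricSpace X] [CompleteSpace X] {φ : C(ℝ, X)}
    (hr : TotallyBounded (range φ)) {C : ℝ≥0} (hφ : LipschitzWith C φ) : LagrangeStable φ := by
  refine ArzelaAscoli.isCompact_closure_of_isClosedEmbedding (𝔖 := {K : Set ℝ | IsCompact K})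
    (F := fun ψ : C(ℝ, X) => (ψ : ℝ → X)) (fun K hK => hK) ?_ (fun K _ => ?_) ?_
  · have : T2Space (UniformOnFun ℝ X {K | IsCompact K}) :=
      UniformOnFun.t2Space_of_covering (eq_univ_of_forall fun x => ⟨{x}, isCompact_singleton, rfl⟩)
    exact ContinuousMap.isUniformEmbedding_toUniformOnFunIsCompact.isClosedEmbedding
  · refine Equicontinuous.equicontinuousOn (UniformEquicontinuous.equicontinuous ?_) K
    refine LipschitzWith.uniformEquicontinuous _ C ?_
    rintro ⟨_, h, rfl⟩
    have h1 : LipschitzWith 1 fun t : ℝ => t + h := LipschitzWith.of_dist_le_mul (by simp)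
    simpa [timeShift, Function.comp_def] using hφ.comp h1
  · refine fun K _ x _ => ⟨_, isCompact_closure_of_totallyBounded hr, ?_⟩
    rintro _ ⟨h, rfl⟩
    exact subset_closure ⟨x + h, rfl⟩

end Lagrange

/-! ### Calculus along the Cauchy operator -/

section Calculus

variable {𝕜 E : Type*} [RCLike 𝕜] [NormedAddCommGroup E] [NormedSpace ℝ E] [NormedSpace 𝕜 E]
  [IsScalarTower ℝ 𝕜 E]

/-- The real normed algebra structure on the bounded `𝕜`-linear operators. -/
noncomputable abbrev operatorRealAlgebra : NormedAlgebra ℝ (E →L[𝕜] E) :=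
  { Algebra.ofModule (fun r x y => by ext; rfl)
      (fun r x y => by
        ext z
        exact map_real_smul x.toAddMonoidHom x.continuous r (y z)) with
    norm_smul_le := norm_smul_le }

/-- The product rule for the value of a variable `𝕜`-linear operator at a variable vector, the
variable being real. -/
theorem HasDerivAt.clm_apply_real {T : ℝ → E →L[𝕜] E} {T' : E →L[𝕜] E} {w : ℝ → E} {w' : E}
    {t : ℝ} (hT : HasDerivAt T T' t) (hw : HasDerivAt w w' t) :
    HasDerivAt (fun s => T s (w s)) (T' (w t) + T t w') t := by
  have h := (ContinuousLinearMap.restrictScalarsL 𝕜 E E ℝ ℝ).hasFDerivAt.comp_hasDerivAt t hT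
  exact h.clm_apply hw

variable [CompleteSpace E]

section Units

variable {V : ℝ → (E →L[𝕜] E)ˣ} {B : ℝ → E →L[𝕜] E}

theorem hasDerivAt_units_inv
    (hV : ∀ t, HasDerivAt (fun s => (V s : E →L[𝕜] E)) (B t * (V t : E →L[𝕜] E)) t) (t : ℝ) :
    HasDerivAt (fun s => (((V s)⁻¹ : (E →L[𝕜] E)ˣ) : E →L[𝕜] E))
      (-(((V t)⁻¹ : (E →L[𝕜] E)ˣ) * B t)) t := by
  let _ : NormedAlgebra ℝ (E →L[𝕜] E) := operatorRealAlgebra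
  have h := (hasFDerivAt_ringInverse (𝕜 := ℝ) (V t)).comp_hasDerivAt t (hV t)
  have h1 : (Ring.inverse ∘ fun s => (V s : E →L[𝕜] E))
      = fun s => (((V s)⁻¹ : (E →L[𝕜] E)ˣ) : E →L[𝕜] E) := by
    funext s; simp
  rw [h1] at h
  refine h.congr_deriv ?_
  simp [mul_assoc]

/-- Variation of constants in differential form. -/
theorem hasDerivAt_units_inv_apply
    (hV : ∀ t, HasDerivAt (fun s => (V s : E →L[𝕜] E)) (B t * (V t : E →L[𝕜] E)) t)
    {w : ℝ → E} {g : E} {t : ℝ} (hw : HasDerivAt w (B t (w t) + g) t) :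
    HasDerivAt (fun s => (((V s)⁻¹ : (E →L[𝕜] E)ˣ) : E →L[𝕜] E) (w s))
      ((((V t)⁻¹ : (E →L[𝕜] E)ˣ) : E →L[𝕜] E) g) t := by
  refine ((hasDerivAt_units_inv hV t).clm_apply_real hw).congr_deriv ?_
  simp

end Units

/-! ### Bounded solutions on a half-line with an exponential dichotomy -/

/-- A comparison form of the mean value inequality, which spares an integral of the majorant. -/
theorem norm_sub_le_of_hasDerivAt {F : Type*} [NormedAddCommGroup F] [NormedSpace ℝ F]
    {p p' : ℝ → F} {b b' : ℝ → ℝ} {x y : ℝ} (hxy : x ≤ y) (hp : ∀ s, HasDerivAt p (p' s) s)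
    (hb : ∀ s, HasDerivAt b (b' s) s) (h : ∀ s ∈ Ico x y, ‖p' s‖ ≤ b' s) :
    ‖p y - p x‖ ≤ b y - b x :=
  image_norm_le_of_norm_deriv_right_le_deriv_boundary
    (f := fun s => p s - p x) (B := fun s => b s - b x)
    (fun s _ => ((hp s).sub_const _).continuousAt.continuousWithinAt)
    (fun s _ => ((hp s).sub_const _).hasDerivWithinAt) (by simp)
    (fun s => (hb s).sub_const _) h (right_mem_Icc.2 hxy)

/-- The equation `w' = B(t) w`, with operator solution `V`, has an exponential dichotomy on
`[0, ∞)` with projection `P` onto the stable directions. -/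
structure HalfLineDichotomy (V : ℝ → (E →L[𝕜] E)ˣ) (B : ℝ → E →L[𝕜] E) (P : E →L[𝕜] E)
    (N ν : ℝ) : Prop where
  deriv : ∀ t, HasDerivAt (fun s => (V s : E →L[𝕜] E)) (B t * (V t : E →L[𝕜] E)) t
  nonneg : 0 ≤ N
  pos : 0 < ν
  stable : ∀ t τ, 0 ≤ τ → τ ≤ t →
    ‖(V t : E →L[𝕜] E) * P * ((V τ)⁻¹ : (E →L[𝕜] E)ˣ)‖ ≤ N * Real.exp (-ν * (t - τ))
  unstable : ∀ t τ, 0 ≤ t → t ≤ τ →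
    ‖(V t : E →L[𝕜] E) * (1 - P) * ((V τ)⁻¹ : (E →L[𝕜] E)ˣ)‖ ≤ N * Real.exp (-ν * (τ - t))

namespace HalfLineDichotomy

variable {V : ℝ → (E →L[𝕜] E)ˣ} {B : ℝ → E →L[𝕜] E} {P : E →L[𝕜] E} {N ν : ℝ}

/-- A bounded solution of `w' = B(t) w + g(t)` is controlled by its initial value, up to an
exponentially small factor, and by a bound of `g`. -/
theorem norm_le (h : HalfLineDichotomy V B P N ν) {w g : ℝ → E}
    (hw : ∀ t, HasDerivAt w (B t (w t) + g t) t) {M G t₀ t : ℝ} (ht₀ : 0 ≤ t₀) (ht : t₀ ≤ t)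
    (hM : ∀ s, t₀ ≤ s → ‖w s‖ ≤ M) (hG : ∀ s, t₀ ≤ s → ‖g s‖ ≤ G) :
    ‖w t‖ ≤ N * M * Real.exp (-ν * (t - t₀)) + 2 * N / ν * G := by
  have hN := h.nonneg
  have hν := h.pos
  have hG0 : 0 ≤ G := (norm_nonneg _).trans (hG t₀ le_rfl)
  have hM0 : 0 ≤ M := (norm_nonneg _).trans (hM t₀ le_rfl)
  obtain ⟨K, hK⟩ : ∃ K : (E →L[𝕜] E) → ℝ → ℝ → E →L[𝕜] E, ∀ R t s,
      K R t s = (V t : E →L[𝕜] E) * R * ((V s)⁻¹ : (E →L[𝕜] E)ˣ) := ⟨_, fun _ _ _ => rfl⟩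
  have hd : ∀ (R : E →L[𝕜] E) (s : ℝ),
      HasDerivAt (fun s => K R t s (w s)) (K R t s (g s)) s := fun R s => by
    simp only [hK]
    refine ((hasDerivAt_const s ((V t : E →L[𝕜] E) * R)).clm_apply_real
      (hasDerivAt_units_inv_apply h.deriv (hw s))).congr_deriv ?_
    simp
  have hstable : ∀ s, 0 ≤ s → s ≤ t → ‖K P t s‖ ≤ N * Real.exp (-ν * (t - s)) := fun s h1 h2 => by
    rw [hK]
    exact h.stable t s h1 h2
  have hunstable : ∀ s, t ≤ s → ‖K (1 - P) t s‖ ≤ N * Real.exp (-ν * (s - t)) := fun s h1 => by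
    rw [hK]
    exact h.unstable t s (ht₀.trans ht) h1
  have hsum : w t = K P t t (w t) + K (1 - P) t t (w t) := by
    rw [hK, hK, ← add_apply, ← add_mul, ← mul_add, add_sub_cancel, mul_one, Units.mul_inv]
    rfl
  have hs : ‖K P t t (w t)‖ ≤ N * M * Real.exp (-ν * (t - t₀)) + N / ν * G := by
    have hb : ∀ s, HasDerivAt (fun s => N / ν * G * Real.exp (-ν * (t - s)))
        (N * Real.exp (-ν * (t - s)) * G) s := fun s => by
      have h1 : HasDerivAt (fun s => -ν * (t - s)) ν s := by
        simpa using ((hasDerivAt_id s).const_sub t).const_mul (-ν)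
      refine (h1.exp.const_mul (N / ν * G)).congr_deriv ?_
      field_simp
    have h2 := norm_sub_le_of_hasDerivAt ht (hd P) hb fun s hs =>
      ((ContinuousLinearMap.le_opNorm _ _).trans (mul_le_mul (hstable s (ht₀.trans hs.1) hs.2.le)
        (hG s hs.1) (norm_nonneg _) (by positivity)))
    have h3 := ((K P t t₀).le_opNorm (w t₀)).trans
      (mul_le_mul (hstable t₀ ht₀ ht) (hM t₀ le_rfl) (norm_nonneg _) (by positivity))
    have h4 := norm_le_norm_add_norm_sub' (K P t t (w t)) (K P t t₀ (w t₀))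
    have h5 : 0 ≤ N / ν * G * Real.exp (-ν * (t - t₀)) := by positivity
    simp only [sub_self, mul_zero, Real.exp_zero, mul_one] at h2
    linarith
  have hu : ‖K (1 - P) t t (w t)‖ ≤ N / ν * G := by
    have hb : ∀ s, HasDerivAt (fun s => -(N / ν * G * Real.exp (-ν * (s - t))))
        (N * Real.exp (-ν * (s - t)) * G) s := fun s => by
      have h1 : HasDerivAt (fun s => -ν * (s - t)) (-ν) s := by
        simpa using ((hasDerivAt_id s).sub_const t).const_mul (-ν)
      refine (h1.exp.const_mul (N / ν * G)).neg.congr_deriv ?_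
      field_simp
    have h2 : ∀ T, t ≤ T →
        ‖K (1 - P) t t (w t)‖ ≤ N * M * Real.exp (-ν * (T - t)) + N / ν * G := fun T hT => by
      have h2 := norm_sub_le_of_hasDerivAt hT (hd (1 - P)) hb fun s hs =>
        ((ContinuousLinearMap.le_opNorm _ _).trans (mul_le_mul
          (hunstable s hs.1) (hG s (ht.trans hs.1)) (norm_nonneg _)
          (by positivity)))
      have h3 := ((K (1 - P) t T).le_opNorm (w T)).trans
        (mul_le_mul (hunstable T hT) (hM T (ht.trans hT)) (norm_nonneg _)
          (by positivity))
      have h4 := norm_le_norm_add_norm_sub (K (1 - P) t T (w T))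
        (K (1 - P) t t (w t))
      have h5 : 0 ≤ N / ν * G * Real.exp (-ν * (T - t)) := by positivity
      simp only [sub_self, mul_zero, Real.exp_zero, mul_one] at h2
      linarith
    have h3 : Tendsto (fun T => N * M * Real.exp (-ν * (T - t)) + N / ν * G) atTop
        (𝓝 (N * M * 0 + N / ν * G)) := by
      refine ((Real.tendsto_exp_atBot.comp ?_).const_mul _).add_const _
      exact (tendsto_atTop_add_const_right _ (-t) tendsto_id).const_mul_atTop_of_neg
        (neg_lt_zero.2 hν)
    rw [mul_zero, zero_add] at h3
    exact ge_of_tendsto h3 ((eventually_ge_atTop t).mono h2)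
  have hmul : 2 * N / ν * G = N / ν * G + N / ν * G := by ring
  rw [hsum, hmul]
  linarith [norm_add_le (K P t t (w t))
    (K (1 - P) t t (w t))]

/-- A bounded solution of `w' = B(t) w + g(t)`, where `g` is small compared with `w` up to an
eventual error `r`, is eventually bounded by a multiple of `r`. -/
theorem eventually_norm_le (h : HalfLineDichotomy V B P N ν) {w g : ℝ → E}
    (hw : ∀ t, HasDerivAt w (B t (w t) + g t) t) {M L r c : ℝ} (hM : ∀ t, ‖w t‖ ≤ M) (hL : 0 ≤ L)
    (hg : ∀ᶠ t in atTop, ‖g t‖ ≤ r + L * ‖w t‖) (hκ : 2 * N / ν * L < 1)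
    (hc : 2 * N / ν * r < (1 - 2 * N / ν * L) * c) : ∀ᶠ t in atTop, ‖w t‖ ≤ c := by
  have hN := h.nonneg
  have hν := h.pos
  -- The infimum `m` of the eventual bounds of `‖w‖` satisfies `m ≤ κ m + (2 N / ν) r`.
  set κ := 2 * N / ν * L with hκd
  have hκ0 : 0 ≤ κ := by positivity
  set S : Set ℝ := {x | ∀ᶠ t in atTop, ‖w t‖ ≤ x}
  have hS0 : ∀ x ∈ S, 0 ≤ x := fun x hx => by
    obtain ⟨t, ht⟩ := hx.exists
    exact (norm_nonneg _).trans ht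
  have hSM : M ∈ S := Eventually.of_forall hM
  have hM0 : 0 ≤ M := hS0 M hSM
  have hbdd : BddBelow S := ⟨0, hS0⟩
  have key : ∀ x ∈ S, ∀ δ > 0, κ * x + 2 * N / ν * r + δ ∈ S := fun x hx δ hδ => by
    obtain ⟨t₀, ht₀⟩ := eventually_atTop.1 ((hx.and hg).and (eventually_ge_atTop 0))
    have ht₀0 : 0 ≤ t₀ := (ht₀ t₀ le_rfl).2
    have hlim : Tendsto (fun t => N * M * Real.exp (-ν * (t - t₀))) atTop (𝓝 (N * M * 0)) := by
      refine (Real.tendsto_exp_atBot.comp ?_).const_mul _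
      exact (tendsto_atTop_add_const_right _ (-t₀) tendsto_id).const_mul_atTop_of_neg
        (neg_lt_zero.2 hν)
    rw [mul_zero] at hlim
    filter_upwards [hlim.eventually (eventually_le_nhds hδ), eventually_ge_atTop t₀] with t h1 h2
    have h3 := h.norm_le hw ht₀0 h2 (fun s _ => hM s) (G := r + L * x) fun s hs =>
      (ht₀ s hs).1.2.trans (by gcongr; exact (ht₀ s hs).1.1)
    have h4 : 2 * N / ν * (r + L * x) = κ * x + 2 * N / ν * r := by rw [hκd]; ring
    linarith
  have hm : sInf S < c := by
    by_contra! hcm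
    have h1 : (1 - κ) * c ≤ (1 - κ) * sInf S := mul_le_mul_of_nonneg_left hcm (by linarith)
    set η := (1 - κ) * sInf S - 2 * N / ν * r
    have hη : 0 < η := by simp only [η]; linarith
    obtain ⟨x, hx, hxm⟩ := exists_lt_of_csInf_lt ⟨M, hSM⟩
      (show sInf S < sInf S + η / 3 by linarith)
    have h2 := csInf_le hbdd (key x hx (η / 3) (by positivity))
    have h3 : κ * x ≤ κ * sInf S + η / 3 := by
      have : κ * (η / 3) ≤ 1 * (η / 3) := mul_le_mul_of_nonneg_right hκ.le (by positivity)
      nlinarith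
    simp only [η] at *
    linarith
  obtain ⟨x, hx, hxc⟩ := exists_lt_of_csInf_lt ⟨M, hSM⟩ hm
  exact hx.mono fun t ht => ht.trans hxc.le

end HalfLineDichotomy

namespace HasExpTrichotomy

variable {A : C(ℝ, E →L[𝕜] E)} {P Q : E →L[𝕜] E} {N ν : ℝ}

theorem halfLineDichotomy (h : HasExpTrichotomy A P Q N ν) :
    HalfLineDichotomy (cauchyOperator A) A P N ν where
  deriv := hasDerivAt_cauchyOperator A
  nonneg := zero_le_one.trans h.one_le
  pos := h.pos
  stable := h.bound_P
  unstable := fun t τ h0 hτ => h.bound_compl_P t τ hτ (h0.trans hτ)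

/-- Reversing time turns the dichotomy on `(-∞, 0]` into one on `[0, ∞)`, for which `Q` projects
onto the stable directions. -/
theorem halfLineDichotomy_neg (h : HasExpTrichotomy A P Q N ν) :
    HalfLineDichotomy (fun t => cauchyOperator A (-t)) (fun t => -A (-t)) Q N ν where
  deriv := fun t => by
    have := (hasDerivAt_cauchyOperator A (-t)).scomp t (hasDerivAt_neg t)
    simpa [Function.comp_def] using this
  nonneg := zero_le_one.trans h.one_le
  pos := h.pos
  stable := fun t τ h0 hτ => by
    simpa [neg_add_eq_sub, conjOp] using h.bound_Q (-t) (-τ) (by linarith) (by linarith)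
  unstable := fun t τ h0 hτ => by
    simpa [neg_add_eq_sub, conjOp] using
      h.bound_compl_Q (-t) (-τ) (by linarith) (by linarith)

/-- A bounded solution on `ℝ` of `w' = A(t) w + g(t)`, where `g` is small compared with `w` up to
an error that is at most `r` near `±∞`, is bounded near `±∞` by a multiple of `r`. -/
theorem eventually_norm_le (h : HasExpTrichotomy A P Q N ν) {w g : ℝ → E}
    (hw : ∀ t, HasDerivAt w (A t (w t) + g t) t) {M L r c : ℝ} (hM : ∀ t, ‖w t‖ ≤ M) (hL : 0 ≤ L)
    (hg : ∀ᶠ t in atBot ⊔ atTop, ‖g t‖ ≤ r + L * ‖w t‖) (hκ : 2 * N / ν * L < 1)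
    (hc : 2 * N / ν * r < (1 - 2 * N / ν * L) * c) : ∀ᶠ t in atBot ⊔ atTop, ‖w t‖ ≤ c := by
  rw [eventually_sup] at hg ⊢
  refine ⟨?_, h.halfLineDichotomy.eventually_norm_le hw hM hL hg.2 hκ hc⟩
  have hw' : ∀ t, HasDerivAt (fun t => w (-t)) ((-A (-t)) (w (-t)) + -g (-t)) t := fun t => by
    refine ((hw (-t)).scomp t (hasDerivAt_neg t)).congr_deriv ?_
    simp [add_comm]
  have := h.halfLineDichotomy_neg.eventually_norm_le hw' (fun t => hM _) hL
    (by simpa using tendsto_neg_atTop_atBot.eventually hg.1) hκ hc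
  simpa using tendsto_neg_atBot_atTop.eventually this

end HasExpTrichotomy

end Calculus

/-! ### Evolution operators of an equation with relatively compact coefficients -/

section Evolution

variable {𝕜 E : Type*} [RCLike 𝕜] [NormedAddCommGroup E] [NormedSpace ℝ E] [NormedSpace 𝕜 E]
  [IsScalarTower ℝ 𝕜 E] [CompleteSpace E] (A : C(ℝ, E →L[𝕜] E))

theorem continuous_cauchyOperator : Continuous fun t => (cauchyOperator A t : E →L[𝕜] E) :=
  continuous_iff_continuousAt.2 fun t => (hasDerivAt_cauchyOperator A t).continuousAt

theorem continuous_cauchyOperator_inv :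
    Continuous fun t => (((cauchyOperator A t)⁻¹ : (E →L[𝕜] E)ˣ) : E →L[𝕜] E) :=
  continuous_iff_continuousAt.2 fun t =>
    (hasDerivAt_units_inv (hasDerivAt_cauchyOperator A) t).continuousAt

theorem continuous_conjOp_left (T : E →L[𝕜] E) (τ : ℝ) : Continuous fun t => conjOp A T t τ :=
  ((continuous_cauchyOperator A).mul continuous_const).mul continuous_const

theorem continuous_conjOp_right (T : E →L[𝕜] E) (t : ℝ) : Continuous fun τ => conjOp A T t τ :=
  continuous_const.mul (continuous_cauchyOperator_inv A)

theorem conjOp_one_self (t : ℝ) : conjOp A 1 t t = 1 := by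
  simp [conjOp]

theorem conjOp_mul_conjOp (S T : E →L[𝕜] E) (t s τ : ℝ) :
    conjOp A S t s * conjOp A T s τ = conjOp A (S * T) t τ := by
  simp only [conjOp, mul_assoc, Units.inv_mul_cancel_left]

theorem conjOp_sub (S T : E →L[𝕜] E) (t τ : ℝ) :
    conjOp A (S - T) t τ = conjOp A S t τ - conjOp A T t τ := by
  simp only [conjOp, mul_sub, sub_mul]

theorem conjOp_one_eq_add_integral (t τ : ℝ) :
    conjOp A 1 t τ = 1 + ∫ s in τ..t, A s * conjOp A 1 s τ := by
  let _ : NormedAlgebra ℝ (E →L[𝕜] E) := operatorRealAlgebra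
  have hd : ∀ s, HasDerivAt (fun s => conjOp A 1 s τ) (A s * conjOp A 1 s τ) s := fun s => by
    have := (hasDerivAt_cauchyOperator A s).mul_const
      (((cauchyOperator A τ)⁻¹ : (E →L[𝕜] E)ˣ) : E →L[𝕜] E)
    simpa [conjOp, mul_assoc] using this
  have := intervalIntegral.integral_eq_sub_of_hasDerivAt (a := τ) (b := t) (fun s _ => hd s)
    ((A.continuous.mul (continuous_conjOp_left A 1 τ)).intervalIntegrable _ _)
  rw [this, conjOp_one_self, add_sub_cancel]

theorem norm_conjOp_one_le {M δ : ℝ} (hM : ∀ t, ‖A t‖ ≤ M) (hδ : δ * M ≤ 1 / 2) {t τ : ℝ}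
    (ht : |t - τ| ≤ δ) : ‖conjOp A 1 t τ‖ ≤ 2 * ‖(1 : E →L[𝕜] E)‖ := by
  have hδ0 : 0 ≤ δ := (abs_nonneg _).trans ht
  -- The maximum `m` of the norm over the interval satisfies `m ≤ ‖1‖ + δ M m ≤ ‖1‖ + m / 2`.
  obtain ⟨s, hs, hmax⟩ := (isCompact_Icc (a := τ - δ) (b := τ + δ)).exists_isMaxOn
    ⟨τ, by constructor <;> linarith⟩ (continuous_conjOp_left A 1 τ).norm.continuousOn
  have hsδ : |s - τ| ≤ δ := abs_le.2 ⟨by linarith [hs.1], by linarith [hs.2]⟩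
  have h1 : ‖∫ r in τ..s, A r * conjOp A 1 r τ‖ ≤ M * ‖conjOp A 1 s τ‖ * |s - τ| := by
    refine intervalIntegral.norm_integral_le_of_norm_le_const fun r hr => ?_
    refine (norm_mul_le _ _).trans (mul_le_mul (hM r) (hmax ?_) (norm_nonneg _)
      ((norm_nonneg _).trans (hM r)))
    exact uIcc_subset_Icc ⟨by linarith, by linarith⟩ hs (uIoc_subset_uIcc hr)
  have h2 : ‖conjOp A 1 s τ‖ ≤ ‖(1 : E →L[𝕜] E)‖ + ‖∫ r in τ..s, A r * conjOp A 1 r τ‖ := by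
    conv_lhs => rw [conjOp_one_eq_add_integral]
    exact norm_add_le _ _
  have h3 : M * ‖conjOp A 1 s τ‖ * |s - τ| ≤ 1 / 2 * ‖conjOp A 1 s τ‖ := by
    have hM0 : 0 ≤ M := (norm_nonneg _).trans (hM 0)
    calc M * ‖conjOp A 1 s τ‖ * |s - τ| ≤ M * ‖conjOp A 1 s τ‖ * δ := by gcongr
      _ = δ * M * ‖conjOp A 1 s τ‖ := by ring
      _ ≤ _ := by gcongr
  have h4 : ‖conjOp A 1 t τ‖ ≤ ‖conjOp A 1 s τ‖ :=
    hmax ⟨by linarith [(abs_le.1 ht).1], by linarith [(abs_le.1 ht).2]⟩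
  linarith

open Metric Pointwise in
/-- If the coefficient has relatively compact range, so have the evolution operators over bounded
time spans. Over short time spans, the integral equation improves any approximation of the evolution
operators by a compact set. -/
theorem totallyBounded_conjOp_one (hA : TotallyBounded (range A)) (T : ℝ) :
    TotallyBounded {W | ∃ t τ, |t - τ| ≤ T ∧ W = conjOp A 1 t τ} := by
  have hAc := isCompact_closure_of_totallyBounded hA
  obtain ⟨M, hM0, hM⟩ : ∃ M > 0, ∀ S ∈ closure (range A), ‖S‖ ≤ M :=
    hAc.isBounded.exists_pos_norm_le
  have hM' : ∀ t, ‖A t‖ ≤ M := fun t => hM _ (subset_closure ⟨t, rfl⟩)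
  set δ := 1 / (2 * M) with hδd
  have hδ : 0 < δ := by positivity
  have hδM : δ * M ≤ 1 / 2 := le_of_eq (by rw [hδd]; field_simp)
  set c := 2 * ‖(1 : E →L[𝕜] E)‖
  have hc : 0 ≤ c := by positivity
  have approx : ∀ n : ℕ, ∃ K : Set (E →L[𝕜] E), IsCompact K ∧
      ∀ t τ, |t - τ| ≤ δ → conjOp A 1 t τ ∈ cthickening ((1 / 2) ^ n * c) K := by
    intro n
    induction n with
    | zero =>
      refine ⟨{0}, isCompact_singleton, fun t τ ht => ?_⟩
      refine mem_cthickening_of_dist_le _ 0 _ _ rfl ?_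
      simpa using norm_conjOp_one_le A hM' hδM ht
    | succ n ih =>
      obtain ⟨K, hK, hKt⟩ := ih
      set ε := (1 / 2 : ℝ) ^ n * c
      have hε : 0 ≤ ε := by positivity
      obtain ⟨K', hK', hint⟩ := exists_isCompact_intervalIntegral_mem (hAc.mul hK) δ
      refine ⟨(fun x => 1 + x) '' K', hK'.image (by fun_prop), fun t τ ht => ?_⟩
      have hI := hint (M * ε) (fun s => A s * conjOp A 1 s τ) τ t (by positivity) ht
        ((A.continuous.mul (continuous_conjOp_left A 1 τ)).intervalIntegrable _ _)
        fun s hs => by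
          have hsτ : |s - τ| ≤ δ := (abs_sub_left_of_mem_uIcc (uIoc_subset_uIcc hs)).trans ht
          have h1 := hKt s τ hsτ
          rw [hK.cthickening_eq_biUnion_closedBall hε] at h1
          obtain ⟨k, hk, hsk⟩ := mem_iUnion₂.1 h1
          refine mem_cthickening_of_dist_le _ (A s * k) _ _
            (mul_mem_mul (subset_closure ⟨s, rfl⟩) hk) ?_
          rw [dist_eq_norm, ← mul_sub]
          refine (norm_mul_le _ _).trans (mul_le_mul (hM' s) ?_ (norm_nonneg _) hM0.le)
          rwa [← dist_eq_norm]
      rw [hK'.cthickening_eq_biUnion_closedBall (by positivity)] at hI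
      obtain ⟨k, hk, hIk⟩ := mem_iUnion₂.1 hI
      refine mem_cthickening_of_dist_le _ (1 + k) _ _ ⟨k, hk, rfl⟩ ?_
      rw [conjOp_one_eq_add_integral, dist_add_left]
      refine (mem_closedBall.1 hIk).trans ?_
      rw [pow_succ, ← mul_assoc]
      calc δ * M * ε ≤ 1 / 2 * ε := by gcongr
        _ = (1 / 2) ^ n * (1 / 2) * c := by simp only [ε]; ring
  have short : TotallyBounded {W | ∃ t τ, |t - τ| ≤ δ ∧ W = conjOp A 1 t τ} := by
    refine totallyBounded_of_subset_cthickening fun ε hε => ?_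
    have hlim : Tendsto (fun n : ℕ => (1 / 2 : ℝ) ^ n * c) atTop (𝓝 (0 * c)) :=
      (tendsto_pow_atTop_nhds_zero_of_lt_one (by norm_num) (by norm_num)).mul_const c
    rw [zero_mul] at hlim
    obtain ⟨n, hn⟩ := (hlim.eventually (eventually_le_nhds hε)).exists
    obtain ⟨K, hK, hKt⟩ := approx n
    refine ⟨K, hK.totallyBounded, ?_⟩
    rintro _ ⟨t, τ, ht, rfl⟩
    exact cthickening_mono hn K (hKt t τ ht)
  have long : ∀ n : ℕ, TotallyBounded {W | ∃ t τ, |t - τ| ≤ n * δ ∧ W = conjOp A 1 t τ} := by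
    intro n
    induction n with
    | zero =>
      refine (totallyBounded_singleton (1 : E →L[𝕜] E)).subset ?_
      rintro _ ⟨t, τ, ht, rfl⟩
      have : t = τ := by simpa [sub_eq_zero] using ht
      rw [this, conjOp_one_self]
      rfl
    | succ n ih =>
      have hc := (isCompact_closure_of_totallyBounded ih).mul
        (isCompact_closure_of_totallyBounded short)
      refine hc.totallyBounded.subset ?_
      rintro _ ⟨t, τ, ht, rfl⟩
      push_cast at ht
      set σ := τ + (t - τ) / (n + 1)
      have hn : (0 : ℝ) < n + 1 := by positivity
      have hστ : |σ - τ| ≤ δ := by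
        simp only [σ, add_sub_cancel_left, abs_div, abs_of_pos hn]
        rw [div_le_iff₀ hn]
        linarith
      have htσ : |t - σ| ≤ n * δ := by
        have h1 : t - σ = n * (σ - τ) := by simp only [σ]; field_simp; ring
        rw [h1, abs_mul, Nat.abs_cast]
        gcongr
      have h2 := conjOp_mul_conjOp A 1 1 t σ τ
      rw [mul_one] at h2
      rw [← h2]
      exact mul_mem_mul (subset_closure ⟨t, σ, htσ, rfl⟩) (subset_closure ⟨σ, τ, hστ, rfl⟩)
  obtain ⟨n, hn⟩ := exists_nat_ge (T / δ)
  refine (long n).subset ?_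
  rintro _ ⟨t, τ, ht, rfl⟩
  exact ⟨t, τ, ht.trans ((div_le_iff₀ hδ).1 hn), rfl⟩

end Evolution

/-! ### The Green operator -/

theorem integrable_exp_neg_mul_abs {ν : ℝ} (hν : 0 < ν) :
    Integrable fun x : ℝ => Real.exp (-ν * |x|) := by
  rw [← integrableOn_univ, ← Iic_union_Ioi (a := (0 : ℝ))]
  refine IntegrableOn.union ?_ ?_
  · refine (integrableOn_exp_mul_Iic hν 0).congr_fun (fun x hx => ?_) measurableSet_Iic
    simp [abs_of_nonpos (mem_Iic.1 hx)]
  · refine (integrableOn_exp_mul_Ioi (neg_lt_zero.2 hν) 0).congr_fun (fun x hx => ?_)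
      measurableSet_Ioi
    simp [abs_of_pos (mem_Ioi.1 hx)]

theorem integral_exp_neg_mul_abs {ν : ℝ} (hν : 0 < ν) :
    ∫ x : ℝ, Real.exp (-ν * |x|) = 2 / ν := by
  rw [integral_comp_abs (f := fun x => Real.exp (-ν * x)),
    integral_exp_mul_Ioi (neg_lt_zero.2 hν) 0]
  simp
  ring

theorem integrable_exp_neg_mul_abs_sub {ν : ℝ} (hν : 0 < ν) (t : ℝ) :
    Integrable fun τ : ℝ => Real.exp (-ν * |t - τ|) :=
  (integrable_exp_neg_mul_abs hν).comp_sub_left t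

theorem integral_exp_neg_mul_abs_sub {ν : ℝ} (hν : 0 < ν) (t : ℝ) :
    ∫ τ : ℝ, Real.exp (-ν * |t - τ|) = 2 / ν := by
  rw [integral_sub_left_eq_self (fun x => Real.exp (-ν * |x|)), integral_exp_neg_mul_abs hν]

section Green

variable {𝕜 E : Type*} [RCLike 𝕜] [NormedAddCommGroup E] [NormedSpace ℝ E] [NormedSpace 𝕜 E]
  [IsScalarTower ℝ 𝕜 E] [CompleteSpace E]

theorem stronglyMeasurable_greenFunction_apply (A : C(ℝ, E →L[𝕜] E)) (P Q : E →L[𝕜] E) (t : ℝ)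
    {g : ℝ → E} (hg : Continuous g) :
    StronglyMeasurable fun τ => greenFunction A P Q t τ (g τ) := by
  have h : ∀ T, StronglyMeasurable fun τ => conjOp A T t τ (g τ) := fun T =>
    ((continuous_conjOp_right A T t).clm_apply hg).stronglyMeasurable
  have heq : (fun τ => greenFunction A P Q t τ (g τ)) = fun τ =>
      if 0 ≤ τ then
        if τ < t then conjOp A P t τ (g τ) else -conjOp A (1 - P) t τ (g τ)
      else
        if t ≤ τ then -conjOp A Q t τ (g τ) else conjOp A (1 - Q) t τ (g τ) := by
    funext τ
    unfold greenFunction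
    split_ifs <;> rfl
  rw [heq]
  exact StronglyMeasurable.ite measurableSet_Ici
    (StronglyMeasurable.ite measurableSet_Iio (h P) (h (1 - P)).neg)
    (StronglyMeasurable.ite measurableSet_Ici (h Q).neg (h (1 - Q)))

/-- As a function of `t`, Green's function is transported by the Cauchy operator, except that it
jumps by the identity when `t` passes `τ`. -/
theorem inv_mul_greenFunction_sub (A : C(ℝ, E →L[𝕜] E)) (P Q : E →L[𝕜] E) {s t : ℝ} (hst : s ≤ t)
    (τ : ℝ) :
    (((cauchyOperator A t)⁻¹ : (E →L[𝕜] E)ˣ) : E →L[𝕜] E) * greenFunction A P Q t τ -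
      (((cauchyOperator A s)⁻¹ : (E →L[𝕜] E)ˣ) : E →L[𝕜] E) * greenFunction A P Q s τ =
    (Ico s t).indicator (fun τ => (((cauchyOperator A τ)⁻¹ : (E →L[𝕜] E)ˣ) : E →L[𝕜] E)) τ := by
  have h : ∀ T r, (((cauchyOperator A r)⁻¹ : (E →L[𝕜] E)ˣ) : E →L[𝕜] E) * conjOp A T r τ
      = T * (((cauchyOperator A τ)⁻¹ : (E →L[𝕜] E)ˣ) : E →L[𝕜] E) := fun T r => by
    simp only [conjOp, mul_assoc, Units.inv_mul_cancel_left]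
  by_cases h1 : s ≤ τ <;> by_cases h2 : τ < t
  · rw [indicator_of_mem (show τ ∈ Ico s t from ⟨h1, h2⟩)]
    by_cases h0 : 0 ≤ τ
    · simp [greenFunction, h0, h2, h1.not_gt, h, sub_mul]
    · simp [greenFunction, h0, h2.not_ge, h1, h, sub_mul]
  · rw [indicator_of_notMem (fun h => h2 h.2)]
    by_cases h0 : 0 ≤ τ
    · simp [greenFunction, h0, h2, h1.not_gt, h]
    · simp [greenFunction, h0, not_lt.1 h2, h1, h]
  · rw [indicator_of_notMem (fun h => h1 h.1)]
    by_cases h0 : 0 ≤ τ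
    · simp [greenFunction, h0, h2, not_le.1 h1, h]
    · simp [greenFunction, h0, h2.not_ge, h1, h]
  · exact absurd (hst.trans (not_lt.1 h2)) h1

namespace HasExpTrichotomy

variable {A : C(ℝ, E →L[𝕜] E)} {P Q : E →L[𝕜] E} {N ν : ℝ}

theorem norm_greenFunction_le (h : HasExpTrichotomy A P Q N ν) (t τ : ℝ) :
    ‖greenFunction A P Q t τ‖ ≤ N * Real.exp (-ν * |t - τ|) := by
  unfold greenFunction
  split_ifs with h0 h1 h1
  · rw [abs_of_pos (sub_pos.2 h1)]
    exact h.bound_P t τ h0 h1.le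
  · rw [norm_neg, abs_sub_comm, abs_of_nonneg (sub_nonneg.2 (not_lt.1 h1))]
    exact h.bound_compl_P t τ (not_lt.1 h1) h0
  · rw [norm_neg, abs_sub_comm, abs_of_nonneg (sub_nonneg.2 h1)]
    exact h.bound_Q t τ h1 (not_le.1 h0).le
  · rw [abs_of_pos (sub_pos.2 (not_le.1 h1))]
    exact h.bound_compl_Q t τ (not_le.1 h1).le (not_le.1 h0).le

theorem norm_greenFunction_apply_le (h : HasExpTrichotomy A P Q N ν) {x : E} {C : ℝ}
    (hx : ‖x‖ ≤ C) (t τ : ℝ) :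
    ‖greenFunction A P Q t τ x‖ ≤ N * C * Real.exp (-ν * |t - τ|) := by
  have hN := zero_le_one.trans h.one_le
  refine (ContinuousLinearMap.le_opNorm _ _).trans ((mul_le_mul (h.norm_greenFunction_le t τ) hx
    (norm_nonneg _) (by positivity)).trans_eq (by ring))

variable {g : ℝ → E} {C : ℝ}

theorem integrable_greenFunction_apply (h : HasExpTrichotomy A P Q N ν) (hg : Continuous g)
    (hC : ∀ τ, ‖g τ‖ ≤ C) (t : ℝ) : Integrable fun τ => greenFunction A P Q t τ (g τ) :=
  ((integrable_exp_neg_mul_abs_sub h.pos t).const_mul (N * C)).mono'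
    (stronglyMeasurable_greenFunction_apply A P Q t hg).aestronglyMeasurable
    (Eventually.of_forall fun τ => h.norm_greenFunction_apply_le (hC τ) t τ)

theorem norm_integral_greenFunction_le (h : HasExpTrichotomy A P Q N ν)
    (hC : ∀ τ, ‖g τ‖ ≤ C) (t : ℝ) :
    ‖∫ τ, greenFunction A P Q t τ (g τ)‖ ≤ 2 * N / ν * C := by
  refine (norm_integral_le_of_norm_le
    ((integrable_exp_neg_mul_abs_sub h.pos t).const_mul (N * C))
    (Eventually.of_forall fun τ => h.norm_greenFunction_apply_le (hC τ) t τ)).trans_eq ?_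
  rw [integral_const_mul, integral_exp_neg_mul_abs_sub h.pos]
  ring

/-- The Green integral of a bounded function `g` solves `u' = A(t) u + g(t)`. -/
theorem hasDerivAt_integral_greenFunction (h : HasExpTrichotomy A P Q N ν) (hg : Continuous g)
    (hC : ∀ τ, ‖g τ‖ ≤ C) (t : ℝ) :
    HasDerivAt (fun t => ∫ τ, greenFunction A P Q t τ (g τ))
      (A t (∫ τ, greenFunction A P Q t τ (g τ)) + g t) t := by
  obtain ⟨I, hI⟩ : ∃ I : ℝ → E →L[𝕜] E, ∀ t,
      I t = (((cauchyOperator A t)⁻¹ : (E →L[𝕜] E)ˣ) : E →L[𝕜] E) := ⟨_, fun _ => rfl⟩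
  have hIc : Continuous fun τ => I τ (g τ) := by
    simp only [hI]
    exact (continuous_cauchyOperator_inv A).clm_apply hg
  set S : ℝ → E := fun t => ∫ τ, greenFunction A P Q t τ (g τ)
  have hint := h.integrable_greenFunction_apply hg hC
  have hle : ∀ s t, s ≤ t → I t (S t) - I s (S s) = ∫ τ in s..t, I τ (g τ) := fun s t hst => by
    have h1 : ∀ r, I r (S r) = ∫ τ, I r (greenFunction A P Q r τ (g τ)) := fun r =>
      ((I r).integral_comp_comm (hint r)).symm
    rw [h1, h1, ← integral_sub ((I t).integrable_comp (hint t)) ((I s).integrable_comp (hint s)),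
      intervalIntegral.integral_of_le hst, ← integral_Ico_eq_integral_Ioc,
      ← integral_indicator measurableSet_Ico]
    congr 1
    funext τ
    have h2 := congrArg (fun T : E →L[𝕜] E => T (g τ)) (inv_mul_greenFunction_sub A P Q hst τ)
    simp only [← hI] at h2
    refine h2.trans ?_
    by_cases hτ : τ ∈ Ico s t
    · rw [indicator_of_mem hτ, indicator_of_mem hτ]
    · rw [indicator_of_notMem hτ, indicator_of_notMem hτ]
      rfl
  have heq : ∀ r, I r (S r) = I 0 (S 0) + ∫ τ in (0 : ℝ)..r, I τ (g τ) := fun r => by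
    rcases le_total 0 r with hr | hr
    · rw [← hle 0 r hr, add_sub_cancel]
    · rw [intervalIntegral.integral_symm, ← hle r 0 hr]
      abel
  have hd : HasDerivAt (fun r => I r (S r)) (I t (g t)) t := by
    rw [funext heq]
    exact (hIc.integral_hasStrictDerivAt 0 t).hasDerivAt.const_add _
  have hU := (hasDerivAt_cauchyOperator A t).clm_apply_real hd
  have hUI : ∀ r x, (cauchyOperator A r : E →L[𝕜] E) (I r x) = x := fun r x => by
    rw [hI, ← mul_apply_eq_comp, Units.mul_inv]
    rfl
  simp only [hUI, mul_apply_eq_comp] at hU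
  exact hU

/-- Over a bounded span of time, Green's function has relatively compact range. -/
theorem totallyBounded_greenFunction (hC : ConditionC A P Q) (hA : TotallyBounded (range A))
    (T : ℝ) : TotallyBounded {G | ∃ t τ, |t - τ| ≤ T ∧ G = greenFunction A P Q t τ} := by
  have hW := isCompact_closure_of_totallyBounded (totallyBounded_conjOp_one A hA T)
  have hc : Continuous fun x : E →L[𝕜] E => -(1 - x) := by fun_prop
  have hD := ((hC.1.union (hC.1.image hc)).union (hC.2.union (hC.2.image hc)))
  have hf : Continuous fun p : (E →L[𝕜] E) × (E →L[𝕜] E) => p.1 * p.2 := by fun_prop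
  refine ((hW.prod hD).image hf).totallyBounded.subset ?_
  rintro _ ⟨t, τ, ht, rfl⟩
  have hW' : conjOp A 1 t τ ∈ closure {W | ∃ t τ, |t - τ| ≤ T ∧ W = conjOp A 1 t τ} :=
    subset_closure ⟨t, τ, ht, rfl⟩
  have hmul : ∀ R, conjOp A 1 t τ * conjOp A R τ τ = conjOp A R t τ := fun R => by
    rw [conjOp_mul_conjOp, one_mul]
  have hcompl : ∀ R, -(1 - conjOp A R τ τ) = -conjOp A (1 - R) τ τ := fun R => by
    rw [conjOp_sub, conjOp_one_self]
  unfold greenFunction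
  split_ifs with h0 h1 h1
  · exact ⟨(conjOp A 1 t τ, conjOp A P τ τ),
      ⟨hW', .inl (.inl (subset_closure ⟨τ, h0, rfl⟩))⟩, hmul P⟩
  · refine ⟨(conjOp A 1 t τ, -conjOp A (1 - P) τ τ), ⟨hW', .inl (.inr ?_)⟩,
      (mul_neg _ _).trans (by rw [hmul])⟩
    exact ⟨_, subset_closure ⟨τ, h0, rfl⟩, hcompl P⟩
  · refine ⟨(conjOp A 1 t τ, -conjOp A Q τ τ), ⟨hW', .inr (.inr ?_)⟩,
      (mul_neg _ _).trans (by rw [hmul])⟩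
    refine ⟨_, subset_closure ⟨τ, (not_le.1 h0).le, rfl⟩, ?_⟩
    simpa using hcompl (1 - Q)
  · exact ⟨(conjOp A 1 t τ, conjOp A (1 - Q) τ τ),
      ⟨hW', .inr (.inl (subset_closure ⟨τ, (not_le.1 h0).le, rfl⟩))⟩, hmul (1 - Q)⟩

/-- The Green integral of a function with relatively compact range has relatively compact range:
its tails are uniformly small, and the rest is a mean of vectors from a compact set. -/
theorem totallyBounded_range_integral_greenFunction (h : HasExpTrichotomy A P Q N ν)
    (hC : ConditionC A P Q) (hA : TotallyBounded (range A)) (hg : Continuous g)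
    (hgr : TotallyBounded (range g)) :
    TotallyBounded (range fun t => ∫ τ, greenFunction A P Q t τ (g τ)) := by
  have hν := h.pos
  have hN := zero_le_one.trans h.one_le
  have hgc := isCompact_closure_of_totallyBounded hgr
  obtain ⟨C, hC0, hgC⟩ : ∃ C > 0, ∀ x ∈ closure (range g), ‖x‖ ≤ C :=
    hgc.isBounded.exists_pos_norm_le
  have hgC' : ∀ τ, ‖g τ‖ ≤ C := fun τ => hgC _ (subset_closure ⟨τ, rfl⟩)
  refine totallyBounded_of_subset_cthickening fun ε hε => ?_
  -- Off `[t - T, t + T]`, `exp (-ν |t - τ|) ≤ exp (-ν T / 2) exp (-ν |t - τ| / 2)`.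
  obtain ⟨T, hT0, hT⟩ : ∃ T : ℝ, 0 ≤ T ∧
      N * C * Real.exp (-(ν / 2) * T) * (2 / (ν / 2)) ≤ ε := by
    have hlim : Tendsto (fun T : ℝ => N * C * Real.exp (-(ν / 2) * T) * (2 / (ν / 2))) atTop
        (𝓝 (N * C * 0 * (2 / (ν / 2)))) := by
      refine ((Real.tendsto_exp_atBot.comp ?_).const_mul _).mul_const _
      exact tendsto_id.const_mul_atTop_of_neg (by linarith)
    rw [mul_zero, zero_mul] at hlim
    obtain ⟨T, h1, h2⟩ := ((eventually_ge_atTop 0).and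
      (hlim.eventually (eventually_le_nhds hε))).exists
    exact ⟨T, h1, h2⟩
  have hGc := isCompact_closure_of_totallyBounded (totallyBounded_greenFunction hC hA T)
  have hap : Continuous fun p : (E →L[𝕜] E) × E => p.1 p.2 := by fun_prop
  obtain ⟨K, hK, hint⟩ := exists_isCompact_intervalIntegral_mem ((hGc.prod hgc).image hap) (2 * T)
  refine ⟨K, hK.totallyBounded, ?_⟩
  rintro _ ⟨t, rfl⟩
  have hi := h.integrable_greenFunction_apply hg hgC' t
  have hmain := hint 0 (fun τ => greenFunction A P Q t τ (g τ)) (t - T) (t + T) le_rfl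
    (by rw [abs_of_nonneg (by linarith)]; linarith) hi.intervalIntegrable fun τ hτ => by
      refine Metric.self_subset_cthickening _
        ⟨(greenFunction A P Q t τ, g τ),
          ⟨subset_closure ⟨t, τ, ?_, rfl⟩, subset_closure ⟨τ, rfl⟩⟩, rfl⟩
      rw [uIoc_of_le (by linarith)] at hτ
      exact abs_le.2 ⟨by linarith [hτ.2], by linarith [hτ.1]⟩
  rw [mul_zero, Metric.cthickening_zero, hK.isClosed.closure_eq] at hmain
  refine Metric.mem_cthickening_of_dist_le _ _ _ _ hmain ?_
  beta_reduce
  rw [intervalIntegral.integral_of_le (by linarith), dist_eq_norm,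
    ← integral_add_compl measurableSet_Ioc hi, add_sub_cancel_left]
  refine le_trans ?_ hT
  rw [← integral_exp_neg_mul_abs_sub (half_pos hν) t, ← integral_const_mul]
  have hi' := (integrable_exp_neg_mul_abs_sub (half_pos hν) t).const_mul
    (N * C * Real.exp (-(ν / 2) * T))
  refine le_trans (norm_integral_le_of_norm_le hi'.integrableOn ?_)
    (setIntegral_le_integral hi' (Eventually.of_forall fun τ => by positivity))
  refine (ae_restrict_iff' measurableSet_Ioc.compl).2 (Eventually.of_forall fun τ hτ => ?_)
  refine (h.norm_greenFunction_apply_le (hgC' τ) t τ).trans ?_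
  rw [mul_assoc (N * C), ← Real.exp_add]
  have hTτ : T ≤ |t - τ| := by
    by_contra! hlt
    obtain ⟨h1, h2⟩ := abs_lt.1 hlt
    exact hτ ⟨by linarith, by linarith⟩
  have : -ν * |t - τ| ≤ -(ν / 2) * T + -(ν / 2) * |t - τ| := by nlinarith
  gcongr

end HasExpTrichotomy

end Green

/-! ### Common remote almost periods -/

/-- `p ε τ` means that `τ` is an `ε`-almost period, in an abstract sense: small shifts are almost
periods, differences of almost periods are almost periods, and the almost periods are relatively
dense. -/
structure AlmostPeriodFamily (p : ℝ → ℝ → Prop) : Prop where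
  small : ∀ ε > 0, ∃ δ > 0, ∀ τ : ℝ, |τ| < δ → p ε τ
  sub : ∀ {a b τ σ : ℝ}, p a τ → p b σ → p (a + b) (τ - σ)
  dense : ∀ ε > 0, RelativelyDense {τ | p ε τ}

namespace AlmostPeriodFamily

/-- Total boundedness of the line in the metric of almost periods: finitely many classes suffice for
any two points of a class to differ by an `ε`-almost period. -/
theorem exists_finite_coloring {p : ℝ → ℝ → Prop} (hp : AlmostPeriodFamily p) {ε : ℝ}
    (hε : 0 < ε) : ∃ c : ℝ → ℕ, (range c).Finite ∧ ∀ t s, c t = c s → p ε (t - s) := by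
  obtain ⟨l, hl, hd⟩ := hp.dense (ε / 3) (by positivity)
  obtain ⟨δ, hδ, hsm⟩ := hp.small (ε / 3) (by positivity)
  choose σ hσ using hd
  -- The class of `t` records the position of `σ t - t ∈ [0, l]` up to the accuracy `δ`.
  refine ⟨fun t => ⌊(σ t - t) / δ⌋₊, (finite_Iic ⌊l / δ⌋₊).subset ?_, fun t s hts => ?_⟩
  · rintro _ ⟨t, rfl⟩
    refine Nat.floor_le_floor ?_
    have := (hσ t).1.2
    gcongr
    linarith
  · have h1 : |(σ t - t) - (σ s - s)| < δ := by
      have h2 : |(σ t - t) / δ - (σ s - s) / δ| < 1 := by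
        have ht := (hσ t).1.1
        have hs := (hσ s).1.1
        have ht1 := Nat.floor_le (div_nonneg (sub_nonneg.2 ht) hδ.le)
        have hs1 := Nat.floor_le (div_nonneg (sub_nonneg.2 hs) hδ.le)
        have ht2 := Nat.lt_floor_add_one ((σ t - t) / δ)
        have hs2 := Nat.lt_floor_add_one ((σ s - s) / δ)
        rw [show ⌊(σ t - t) / δ⌋₊ = ⌊(σ s - s) / δ⌋₊ from hts] at ht1 ht2
        exact abs_lt.2 ⟨by linarith, by linarith⟩
      rwa [← sub_div, abs_div, abs_of_pos hδ, div_lt_one hδ] at h2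
    have h3 := hp.sub (hp.sub (hσ t).2 (hσ s).2) (hsm _ h1)
    convert h3 using 1 <;> ring

theorem and {p q : ℝ → ℝ → Prop} (hp : AlmostPeriodFamily p) (hq : AlmostPeriodFamily q) :
    AlmostPeriodFamily fun ε τ => p ε τ ∧ q ε τ where
  small ε hε := by
    obtain ⟨δ₁, h1, hp1⟩ := hp.small ε hε
    obtain ⟨δ₂, h2, hq2⟩ := hq.small ε hε
    exact ⟨min δ₁ δ₂, lt_min h1 h2, fun τ hτ =>
      ⟨hp1 τ (hτ.trans_le (min_le_left _ _)), hq2 τ (hτ.trans_le (min_le_right _ _))⟩⟩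
  sub h1 h2 := ⟨hp.sub h1.1 h2.1, hq.sub h1.2 h2.2⟩
  dense ε hε := by
    obtain ⟨c, hc, hcp⟩ := hp.exists_finite_coloring hε
    obtain ⟨d, hd, hdq⟩ := hq.exists_finite_coloring hε
    have hfin : (range fun t => (c t, d t)).Finite := by
      refine (hc.prod hd).subset ?_
      rintro _ ⟨t, rfl⟩
      exact ⟨⟨t, rfl⟩, ⟨t, rfl⟩⟩
    -- `R` bounds representatives `ρ` of the common classes.
    choose! ρ hρ using fun (y : ℕ × ℕ) (hy : y ∈ range fun t => (c t, d t)) => hy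
    obtain ⟨R, hR0, hR⟩ := (hfin.image ρ).isBounded.exists_pos_norm_le
    refine ⟨2 * R, by positivity, fun a => ?_⟩
    set t := a + R
    have hmem : (c t, d t) ∈ range fun t => (c t, d t) := ⟨t, rfl⟩
    have h1 := hρ _ hmem
    have h2 := abs_le.1 (hR _ ⟨_, hmem, rfl⟩)
    exact ⟨t - ρ (c t, d t), ⟨by simp only [t]; linarith [h2.2], by simp only [t]; linarith [h2.1]⟩,
      hcp _ _ (congrArg Prod.fst h1).symm, hdq _ _ (congrArg Prod.snd h1).symm⟩

end AlmostPeriodFamily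

theorem tendsto_add_const_atBot_sup_atTop (c : ℝ) :
    Tendsto (fun t => t + c) (atBot ⊔ atTop) (atBot ⊔ atTop) :=
  (tendsto_atBot_add_const_right _ c tendsto_id).sup_sup
    (tendsto_atTop_add_const_right _ c tendsto_id)

theorem exists_forall_le_abs_iff {p : ℝ → Prop} :
    (∃ L > 0, ∀ t : ℝ, L ≤ |t| → p t) ↔ ∀ᶠ t in atBot ⊔ atTop, p t := by
  rw [eventually_sup]
  constructor
  · rintro ⟨L, -, h⟩
    exact ⟨(eventually_le_atBot (-L)).mono fun t ht => h t (le_abs.2 (.inr (by linarith))),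
      (eventually_ge_atTop L).mono fun t ht => h t (le_abs.2 (.inl ht))⟩
  · rintro ⟨h1, h2⟩
    obtain ⟨a, ha⟩ := eventually_atBot.1 h1
    obtain ⟨b, hb⟩ := eventually_atTop.1 h2
    refine ⟨max 1 (max (-a) b), by positivity, fun t ht => ?_⟩
    have h3 : -a ≤ |t| := (le_max_left _ _).trans ((le_max_right _ _).trans ht)
    have h4 : b ≤ |t| := (le_max_right _ _).trans ((le_max_right _ _).trans ht)
    rcases le_total 0 t with h0 | h0
    · exact hb t (by rwa [abs_of_nonneg h0] at h4)
    · exact ha t (by rw [abs_of_nonpos h0] at h3; linarith)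

section Recurrence

variable {W X : Type*} [PseudoMetricSpace X]

theorem remotelyPeriodic_iff {τ : ℝ} {φ : ℝ → X} :
    RemotelyPeriodic τ φ ↔
      ∀ ε > 0, ∀ᶠ t in atBot ⊔ atTop, dist (φ (t + τ)) (φ t) < ε := by
  rw [RemotelyPeriodic, and_comm, ← tendsto_sup, Metric.tendsto_nhds]
  simp

theorem remotelyPeriodicOn_iff {τ : ℝ} {F : ℝ × W → X} {Q : Set W} :
    RemotelyPeriodicOn τ F Q ↔
      ∀ ε > 0, ∀ᶠ t in atBot ⊔ atTop, ∀ x ∈ Q, dist (F (t + τ, x)) (F (t, x)) < ε := by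
  simp only [RemotelyPeriodicOn, eventually_sup, and_comm]

/-- For a function that is uniformly continuous in time, the remote almost periods, uniform over
`Q`, form an almost period family. -/
theorem almostPeriodFamily_remote {F : ℝ × W → X} {Q : Set W}
    (huc : ∀ ε > 0, ∃ δ > 0, ∀ τ : ℝ, |τ| < δ → ∀ t, ∀ x ∈ Q, dist (F (t + τ, x)) (F (t, x)) < ε)
    (h : RemotelyAlmostPeriodicOn F Q) :
    AlmostPeriodFamily fun ε τ =>
      ∀ᶠ t in atBot ⊔ atTop, ∀ x ∈ Q, dist (F (t + τ, x)) (F (t, x)) < ε where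
  small ε hε := by
    obtain ⟨δ, hδ, H⟩ := huc ε hε
    exact ⟨δ, hδ, fun τ hτ => Eventually.of_forall (H τ hτ)⟩
  sub {a b τ σ} h1 h2 := by
    have hs := tendsto_add_const_atBot_sup_atTop (-σ)
    filter_upwards [hs.eventually h1, hs.eventually h2] with t ht1 ht2 x hx
    have h3 := ht1 x hx
    have h4 := ht2 x hx
    rw [neg_add_cancel_right, dist_comm] at h4
    rw [show t + (τ - σ) = t + -σ + τ by ring]
    exact (dist_triangle _ _ _).trans_lt (add_lt_add h3 h4)
  dense ε hε := by
    obtain ⟨S, ⟨l, hl, hS⟩, H⟩ := h ε hε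
    exact ⟨l, hl, fun a => (hS a).mono fun τ hτ =>
      ⟨hτ.1, exists_forall_le_abs_iff.1 (H τ hτ.2)⟩⟩

theorem LagrangeStable.almostPeriodFamily {φ : C(ℝ, X)} (hφ : LagrangeStable φ)
    (h : RemotelyAlmostPeriodic φ) :
    AlmostPeriodFamily fun ε τ => ∀ᶠ t in atBot ⊔ atTop, dist (φ (t + τ)) (φ t) < ε := by
  have := almostPeriodFamily_remote (F := fun p : ℝ × Unit => φ p.1) (Q := univ)
    (fun ε hε => by simpa using hφ.exists_dist_lt hε)
    (by simpa [RemotelyAlmostPeriodic, RemotelyAlmostPeriodicOn] using h)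
  simpa using this

theorem LagrangeStable₂.almostPeriodFamily [TopologicalSpace W] [R1Space W] {F : C(ℝ × W, X)}
    (hF : LagrangeStable₂ F) {Q : Set W} (hQ : IsCompact Q) (h : RemotelyAlmostPeriodicOn F Q) :
    AlmostPeriodFamily fun ε τ =>
      ∀ᶠ t in atBot ⊔ atTop, ∀ x ∈ Q, dist (F (t + τ, x)) (F (t, x)) < ε :=
  almostPeriodFamily_remote (fun _ hε => hF.exists_dist_lt hQ hε) h

end Recurrence

/-! ### The semilinear equation -/

section Semilinear

variable {𝕜 E : Type*} [RCLike 𝕜] [NormedAddCommGroup E] [NormedSpace ℝ E] [NormedSpace 𝕜 E]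
  [IsScalarTower ℝ 𝕜 E] [CompleteSpace E] {A : C(ℝ, E →L[𝕜] E)} {f : C(ℝ, E)} {F : C(ℝ × E, E)}
  {P Q : E →L[𝕜] E} {N ν : ℝ} {L : ℝ≥0}

theorem LagrangeStable.exists_norm_le {X : Type*} [NormedAddCommGroup X] {φ : C(ℝ, X)}
    (h : LagrangeStable φ) : ∃ C > 0, ∀ t, ‖φ t‖ ≤ C := by
  obtain ⟨C, hC, H⟩ := h.isCompact_closure_range.isBounded.exists_pos_norm_le
  exact ⟨C, hC, fun t => H _ (subset_closure ⟨t, rfl⟩)⟩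

theorem HasExpTrichotomy.mul_lt_one (h : HasExpTrichotomy A P Q N ν)
    (hL : (L : ℝ) < ν / (2 * N)) : 2 * N / ν * L < 1 := by
  have hN : 0 < N := zero_lt_one.trans_le h.one_le
  have hν := h.pos
  rw [lt_div_iff₀ (by positivity)] at hL
  rw [div_mul_eq_mul_div, div_lt_one hν]
  linarith

open BoundedContinuousFunction in
/-- The Green operator makes the equation a contraction of the space of bounded continuous
functions. Its fixed point is a uniform limit of functions with relatively compact range. -/
theorem existsUnique_lagrangeStable_green (hA : HasExpTrichotomy A P Q N ν)
    (hC : ConditionC A P Q) (hAL : LagrangeStable A) (hfL : LagrangeStable f)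
    (hFL : LagrangeStable₂ F) (hLip : ∀ t, LipschitzWith L (fun x => F (t, x)))
    (hL : (L : ℝ) < ν / (2 * N)) :
    ∃! φ : C(ℝ, E), LagrangeStable φ ∧ IsSolution A f F φ ∧ IsGreenSolution A P Q f F φ := by
  have hN : 0 ≤ N := zero_le_one.trans hA.one_le
  have hν := hA.pos
  have hκ := hA.mul_lt_one hL
  obtain ⟨CA, hCA, hCA'⟩ := hAL.exists_norm_le
  have hfr := hfL.isCompact_closure_range
  have hAr := totallyBounded_of_isCompact_closure hAL.isCompact_closure_range
  -- The inhomogeneity along a bounded function is bounded and continuous.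
  have hgc : ∀ φ : ℝ →ᵇ E, Continuous fun τ => f τ + F (τ, φ τ) := fun φ => by fun_prop
  have hgb : ∀ φ : ℝ →ᵇ E, ∃ C, ∀ τ, ‖f τ + F (τ, φ τ)‖ ≤ C := fun φ => by
    obtain ⟨Cf, -, hCf⟩ := hfL.exists_norm_le
    obtain ⟨K, hK, hFK⟩ := hFL.exists_isCompact_mem (isCompact_singleton (x := (0 : E)))
    obtain ⟨C0, -, hC0⟩ := hK.isBounded.exists_pos_norm_le
    refine ⟨Cf + (C0 + L * ‖φ‖), fun τ => (norm_add_le _ _).trans (add_le_add (hCf τ) ?_)⟩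
    have h1 := (hLip τ).norm_sub_le (φ τ) 0
    rw [sub_zero] at h1
    have h2 := hC0 _ (hFK τ 0 rfl)
    have h3 : (L : ℝ) * ‖φ τ‖ ≤ L * ‖φ‖ := by gcongr; exact φ.norm_coe_le_norm τ
    linarith [norm_le_norm_add_norm_sub' (F (τ, φ τ)) (F (τ, 0))]
  have hex : ∀ φ : ℝ →ᵇ E, ∃ ψ : ℝ →ᵇ E,
      ∀ t, ψ t = ∫ τ, greenFunction A P Q t τ (f τ + F (τ, φ τ)) := fun φ => by
    obtain ⟨C, hgC⟩ := hgb φ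
    exact ⟨ofNormedAddCommGroup _ (continuous_iff_continuousAt.2 fun t =>
      (hA.hasDerivAt_integral_greenFunction (hgc φ) hgC t).continuousAt) _
      (hA.norm_integral_greenFunction_le hgC), fun t => rfl⟩
  choose Ψ hΨ using hex
  have hint : ∀ (φ : ℝ →ᵇ E) t,
      Integrable fun τ => greenFunction A P Q t τ (f τ + F (τ, φ τ)) := fun φ t => by
    obtain ⟨C, hgC⟩ := hgb φ
    exact hA.integrable_greenFunction_apply (hgc φ) hgC t
  obtain ⟨κ, hκeq⟩ : ∃ κ : ℝ≥0, (κ : ℝ) = 2 * N / ν * L := ⟨⟨_, by positivity⟩, rfl⟩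
  have hcon : ContractingWith κ Ψ := by
    refine ⟨by rwa [← hκeq, ← NNReal.coe_one, NNReal.coe_lt_coe] at hκ,
      LipschitzWith.of_dist_le_mul fun φ ψ => ?_⟩
    refine (BoundedContinuousFunction.dist_le (by positivity)).2 fun t => ?_
    rw [dist_eq_norm, hΨ, hΨ, ← integral_sub (hint φ t) (hint ψ t)]
    simp only [← map_sub, add_sub_add_left_eq_sub]
    refine (hA.norm_integral_greenFunction_le (C := L * dist φ ψ) (fun τ => ?_) t).trans_eq
      (by rw [hκeq, mul_assoc])
    rw [← dist_eq_norm]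
    exact ((hLip τ).dist_le_mul _ _).trans (by gcongr; exact dist_coe_le_dist τ)
  have hTB : ∀ φ : ℝ →ᵇ E, TotallyBounded (range φ) → TotallyBounded (range (Ψ φ)) :=
    fun φ hφ => by
      obtain ⟨K, hK, hFK⟩ := hFL.exists_isCompact_mem (isCompact_closure_of_totallyBounded hφ)
      have hg : TotallyBounded (range fun τ => f τ + F (τ, φ τ)) := by
        have hadd : Continuous fun p : E × E => p.1 + p.2 := by fun_prop
        refine ((hfr.prod hK).image hadd).totallyBounded.subset ?_
        rintro _ ⟨τ, rfl⟩
        exact ⟨(f τ, F (τ, φ τ)), ⟨subset_closure ⟨τ, rfl⟩,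
          hFK τ _ (subset_closure ⟨τ, rfl⟩)⟩, rfl⟩
      have := hA.totallyBounded_range_integral_greenFunction hC hAr (hgc φ) hg
      simpa only [← hΨ] using this
  obtain ⟨φ, hφ⟩ : ∃ φ, φ = hcon.fixedPoint := ⟨_, rfl⟩
  have hfix : Ψ φ = φ := by
    rw [hφ]
    exact hcon.fixedPoint_isFixedPt
  have hrange : TotallyBounded (range φ) := by
    have hn : ∀ n, TotallyBounded (range (Ψ^[n] 0)) := fun n => by
      induction n with
      | zero =>
        refine (totallyBounded_singleton (0 : E)).subset ?_
        rintro _ ⟨t, rfl⟩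
        rfl
      | succ n ih =>
        rw [Function.iterate_succ_apply']
        exact hTB _ ih
    refine totallyBounded_of_subset_cthickening fun ε hε => ?_
    obtain ⟨n, hnε⟩ := ((hcon.tendsto_iterate_fixedPoint 0).eventually
      (Metric.closedBall_mem_nhds _ hε)).exists
    rw [← hφ, dist_comm] at hnε
    refine ⟨_, hn n, ?_⟩
    rintro _ ⟨t, rfl⟩
    exact Metric.mem_cthickening_of_dist_le _ _ _ _ ⟨t, rfl⟩ ((dist_coe_le_dist t).trans hnε)
  obtain ⟨C, hgC⟩ := hgb φ
  have hint' : ∀ t, φ t = ∫ τ, greenFunction A P Q t τ (f τ + F (τ, φ τ)) := fun t => by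
    rw [← hΨ, hfix]
  have hsol : IsSolution A f F φ.toContinuousMap := fun t => by
    have := hA.hasDerivAt_integral_greenFunction (hgc φ) hgC t
    simp only [← hint'] at this
    rw [← add_assoc] at this
    exact this
  have hlip : LipschitzWith (Real.toNNReal (CA * ‖φ‖ + C)) φ.toContinuousMap := by
    refine lipschitzWith_of_nnnorm_deriv_le (fun t => (hsol t).differentiableAt) fun t => ?_
    rw [(hsol t).deriv, ← NNReal.coe_le_coe, coe_nnnorm, add_assoc]
    refine le_trans ((norm_add_le _ _).trans (add_le_add ?_ (hgC t))) (Real.le_coe_toNNReal _)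
    exact ((A t).le_opNorm _).trans
      (mul_le_mul (hCA' t) (φ.norm_coe_le_norm t) (norm_nonneg _) hCA.le)
  refine ⟨φ.toContinuousMap, ⟨lagrangeStable_of_lipschitzWith hrange hlip, hsol,
    fun t => ⟨hint φ t, hint' t⟩⟩, ?_⟩
  rintro ψ ⟨hψL, -, hψ⟩
  obtain ⟨M, -, hM⟩ := hψL.exists_norm_le
  have hψfix : Ψ (ofNormedAddCommGroup ψ ψ.continuous M hM)
      = ofNormedAddCommGroup ψ ψ.continuous M hM := by
    ext t
    rw [hΨ]
    exact (hψ t).2.symm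
  have hψφ := hcon.fixedPoint_unique hψfix
  rw [← hφ] at hψφ
  ext t
  exact congrArg (fun u : ℝ →ᵇ E => u t) hψφ

/-- For a Lagrange stable solution `φ`, a sufficiently accurate common remote almost period of the
coefficients is a remote `ε`-almost period of `φ`. Indeed, the difference of `φ` and its translate
solves a linear equation whose right-hand side is small near `±∞`, up to a Lipschitz term. -/
theorem IsSolution.exists_remote_modulus (hA : HasExpTrichotomy A P Q N ν)
    (hLip : ∀ t, LipschitzWith L (fun x => F (t, x))) (hL : (L : ℝ) < ν / (2 * N))
    {φ : C(ℝ, E)} (hφL : LagrangeStable φ) (hφ : IsSolution A f F φ) {ε : ℝ} (hε : 0 < ε) :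
    ∃ δ > 0, ∀ τ : ℝ,
      (∀ᶠ t in atBot ⊔ atTop, dist (A (t + τ)) (A t) < δ) →
      (∀ᶠ t in atBot ⊔ atTop, dist (f (t + τ)) (f t) < δ) →
      (∀ᶠ t in atBot ⊔ atTop, ∀ x ∈ closure (range φ), dist (F (t + τ, x)) (F (t, x)) < δ) →
      ∀ᶠ t in atBot ⊔ atTop, dist (φ (t + τ)) (φ t) < ε := by
  have hκ := hA.mul_lt_one hL
  obtain ⟨M, hM0, hM⟩ := hφL.exists_norm_le
  obtain ⟨δ, hδ, hδε⟩ := exists_pos_mul_lt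
    (show 0 < (1 - 2 * N / ν * L) * (ε / 2) from mul_pos (by linarith) (by linarith))
    (2 * N / ν * (M + 2))
  refine ⟨δ, hδ, fun τ hAτ hfτ hFτ => ?_⟩
  set w : ℝ → E := fun t => φ (t + τ) - φ t
  set g : ℝ → E := fun t => (A (t + τ) - A t) (φ (t + τ)) + (f (t + τ) - f t) +
    (F (t + τ, φ (t + τ)) - F (t, φ (t + τ))) + (F (t, φ (t + τ)) - F (t, φ t))
  have hw : ∀ t, HasDerivAt w (A t (w t) + g t) t := fun t => by
    refine (((hφ (t + τ)).comp_add_const t τ).sub (hφ t)).congr_deriv ?_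
    simp only [w, g, map_sub, sub_apply]
    abel
  have hwM : ∀ t, ‖w t‖ ≤ M + M := fun t =>
    (norm_sub_le _ _).trans (add_le_add (hM _) (hM _))
  have hg : ∀ᶠ t in atBot ⊔ atTop, ‖g t‖ ≤ δ * (M + 2) + L * ‖w t‖ := by
    filter_upwards [hAτ, hfτ, hFτ] with t h1 h2 h3
    have h4 := h3 (φ (t + τ)) (subset_closure ⟨_, rfl⟩)
    rw [dist_eq_norm] at h1 h2 h4
    have h5 : ‖(A (t + τ) - A t) (φ (t + τ))‖ ≤ δ * M :=
      (ContinuousLinearMap.le_opNorm _ _).trans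
        (mul_le_mul h1.le (hM _) (norm_nonneg _) hδ.le)
    have h6 : ‖F (t, φ (t + τ)) - F (t, φ t)‖ ≤ L * ‖w t‖ := (hLip t).norm_sub_le _ _
    calc ‖g t‖ ≤ δ * M + δ + δ + L * ‖w t‖ :=
          norm_add_le_of_le (norm_add_le_of_le (norm_add_le_of_le h5 h2.le) h4.le) h6
      _ = δ * (M + 2) + L * ‖w t‖ := by ring
  have := hA.eventually_norm_le hw hwM L.2 hg hκ (c := ε / 2)
    (lt_of_eq_of_lt (by ring) hδε)
  filter_upwards [this] with t ht
  rw [dist_eq_norm]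
  exact ht.trans_lt (half_lt_self hε)

end Semilinear

theorem corollary6p1 {𝕜 E : Type*} [RCLike 𝕜] [NormedAddCommGroup E] [NormedSpace ℝ E]
    [NormedSpace 𝕜 E] [IsScalarTower ℝ 𝕜 E] [CompleteSpace E]
    (A : C(ℝ, E →L[𝕜] E)) (f : C(ℝ, E)) (F : C(ℝ × E, E))
    (P Q : E →L[𝕜] E) (N ν : ℝ) (hA : HasExpTrichotomy A P Q N ν)
    (hC : ConditionC A P Q)
    (hAL : LagrangeStable A) (hfL : LagrangeStable f) (hFL : LagrangeStable₂ F)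
    (L : ℝ≥0) (hLip : ∀ t, LipschitzWith L (fun x => F (t, x))) (hL : (L : ℝ) < ν / (2 * N)) :
    (∃! φ : C(ℝ, E), LagrangeStable φ ∧ IsSolution A f F φ ∧ IsGreenSolution A P Q f F φ) ∧
    ∀ φ : C(ℝ, E), LagrangeStable φ → IsSolution A f F φ →
      (RemotelyStationary A → RemotelyStationary f →
        RemotelyStationaryOn F (closure (range φ)) → RemotelyStationary φ) ∧
      (∀ τ > 0, RemotelyPeriodic τ A → RemotelyPeriodic τ f →
        RemotelyPeriodicOn τ F (closure (range φ)) → RemotelyPeriodic τ φ) ∧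
      (RemotelyAlmostPeriodic A → RemotelyAlmostPeriodic f →
        RemotelyAlmostPeriodicOn F (closure (range φ)) → RemotelyAlmostPeriodic φ) := by
  refine ⟨existsUnique_lagrangeStable_green hA hC hAL hfL hFL hLip hL, fun φ hφL hφ => ?_⟩
  have hper : ∀ τ, RemotelyPeriodic τ A → RemotelyPeriodic τ f →
      RemotelyPeriodicOn τ F (closure (range φ)) → RemotelyPeriodic τ φ := fun τ h1 h2 h3 => by
    rw [remotelyPeriodic_iff] at h1 h2 ⊢
    rw [remotelyPeriodicOn_iff] at h3
    intro ε hε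
    obtain ⟨δ, hδ, H⟩ := hφ.exists_remote_modulus hA hLip hL hφL hε
    exact H τ (h1 δ hδ) (h2 δ hδ) (h3 δ hδ)
  refine ⟨fun h1 h2 h3 τ hτ => hper τ (h1 τ hτ) (h2 τ hτ) (h3 τ hτ), fun τ _ => hper τ,
    fun h1 h2 h3 ε hε => ?_⟩
  obtain ⟨δ, hδ, H⟩ := hφ.exists_remote_modulus hA hLip hL hφL hε
  have hfam := (hAL.almostPeriodFamily h1).and ((hfL.almostPeriodFamily h2).and
    (hFL.almostPeriodFamily hφL.isCompact_closure_range h3))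
  exact ⟨_, hfam.dense δ hδ, fun τ hτ =>
    exists_forall_le_abs_iff.2 (H τ hτ.1 hτ.2.1 hτ.2.2)⟩
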